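/- **Setting.** Let $G=(V,E)$ be a finite connected directed graph. For each $v\in V$ let $S_v$ be a finite set and $P_v$ an irreducible aperiodic stochastic matrix on $S_v$ with stationary distribution $\pi_v$; for each $v\in V$, $s\in S_v$ let $\nu^{v,s}$ be a probability distribution on $\mathbb Z^V$, $\xi^{v,s}$ a sample from it, and $\mu^{v,s}=\mathbb E[\xi^{v,s}]\in\mathbb R^V$ its (finite) expectation. Let $\mathsf t:V\to\mathbb N_0$ be a threshold and $q_0\in\prod_{v}S_v$ an initial environment. The stochastic network started at $\eta_0:V\to\mathbb N_0$ is the Markov chain $(\eta_n,q_n)_{n\ge 0}$ started at $(\eta_0,q_0)$ defined as follows. If $\eta_n(v)\le \mathsf t(v)$ for all $v$ (a stable configuration), then $(\eta_{n+1},q_{n+1})=(\eta_n,q_n)$. Otherwise a vertex $\mathsf v$ is chosen with probability $\max\{\eta_n(\mathsf v)-\mathsf t(\mathsf v),0\}/\sum_w\max\{\eta_n(w)-\mathsf t(w),0\}$; the environment at $\mathsf v$ moves to a state $s$ with probability $P_{\mathsf v}(q_n(\mathsf v),s)$, the other environments stay unchanged, and $\eta_{n+1}=\eta_n+\xi$ with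 $\xi$ sampled from $\nu^{\mathsf v,s}$. The network stabilizes if $\eta_n$ is stable for some $n$. Let $M(v,w)=\sum_{s\in S_v}\pi_v(s)\mu^{v,s}(w)$, and assume: * (MOLI) for all $v$, all $s\in S_v$ and all $w\ne v$, almost surely $\xi^{v,s}(w)\ge 0$; * (BFB) for all $v$ and all $s\in S_v$, almost surely $-\xi^{v,s}(v)\le \mathsf t(v)$; * (IRR) there is $k\in\mathbb N_0$ with $(M-\mathrm{Diag}(M))^k(v,w)>0$ for all $v\neq w$, where $\mathrm{Diag}(M)$ is the diagonal part of $M$. A *conserved quantity* consists of $a\in\mathbb R^V$, $a\neq 0$, and functions $\varphi(v,\cdot):S_v\to\mathbb R$ such that, from every initial configuration and every initial environment, almost surely $\sum_{v}\big(a(v)\eta_n(v)+\varphi(v,q_n(v))\big)$ does not depend on $n$. **Theorem 1.1.** Let $\alpha=1+\max_{v}(-M(v,v))$ and $\rho=r(M+\alpha I)-\alpha$, where $r(M+\alpha I)$ is the Perron–Frobenius eigenvalue (spectral radius) of $M+\alpha I$. 1. If $\rho<0$, then for every $\eta_0:V\to\mathbb N_0$ the network stabilizes almost surely. 2. If $\rho=0$,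 then either there exists a conserved quantity, or the network stabilizes almost surely for every $\eta_0:V\to\mathbb N_0$, and not both. 3. If $\rho>0$, then there exists $\eta_0:V\to\mathbb N_0$ for which, with positive probability, the network does not stabilize. -/

import Mathlib

open MeasureTheory ProbabilityTheory
open scoped ENNReal

/-- The data of a stochastic network in a Markovian environment on the vertex set `V`, where
`S v` is the set of environment states at `v`:
* `P v` is the stochastic transition matrix of the environment at `v`, given by its rows;
* `ν v s` is the law on `ℤ^V` of a toppling at `v` when the environment at `v` is in state `s`;
* `t` is the toppling threshold. -/
structure StochasticNetwork (V : Type*) (S : V → Type*) where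
  P : ∀ v, S v → PMF (S v)
  ν : ∀ v, S v → PMF (V → ℤ)
  t : V → ℕ

namespace StochasticNetwork

/-- A state `(η, q)`: a particle configuration together with a global environment. -/
structure State (V : Type*) (S : V → Type*) where
  η : V → ℤ
  q : ∀ v, S v

/-- The state space is countable for finite `V` and `S v`, and carries the discrete
σ-algebra. -/
instance (V : Type*) (S : V → Type*) : MeasurableSpace (State V S) := ⊤

variable {V : Type*} {S : V → Type*} (N : StochasticNetwork V S)

/-! ### The Markov chain `(η_n, q_n)` -/

/-- The configuration `η` is stable: `η(v) ≤ t(v)` at every vertex. -/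
def Stable (η : V → ℤ) : Prop := ∀ v, η v ≤ N.t v

/-- The weight `max {η(v) - t(v), 0}` with which `v` is selected. -/
noncomputable def weight (η : V → ℤ) (v : V) : ℝ≥0∞ := ((η v - N.t v).toNat : ℝ≥0∞)

theorem tsum_weight_ne_zero {η : V → ℤ} (h : ¬ N.Stable η) : ∑' v, N.weight η v ≠ 0 := by
  intro h0
  apply h
  intro v
  have h1 := ENNReal.tsum_eq_zero.1 h0 v
  simp only [weight, Nat.cast_eq_zero] at h1
  omega

theorem tsum_weight_ne_top [Fintype V] (η : V → ℤ) : ∑' v, N.weight η v ≠ ∞ := by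
  rw [tsum_fintype]
  exact ENNReal.sum_ne_top.2 fun v _ => ENNReal.natCast_ne_top _

/-- The law of the vertex to be toppled in an unstable configuration: `v` has probability
`max {η(v) - t(v), 0} / ∑ w, max {η(w) - t(w), 0}`. -/
noncomputable def selectVertex [Fintype V] (η : V → ℤ) (h : ¬ N.Stable η) : PMF V :=
  PMF.normalize (N.weight η) (N.tsum_weight_ne_zero h) (N.tsum_weight_ne_top η)

/-- The law of the state after a toppling at `v`: first the environment at `v` moves to a state
`s` sampled from `P v`, then a sample of `ν v s` is added to the configuration. -/
noncomputable def topple [DecidableEq V] (x : State V S) (v : V) : PMF (State V S) :=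
  (N.P v (x.q v)).bind fun s =>
    (N.ν v s).map fun ξ => ⟨x.η + ξ, Function.update x.q v s⟩

open Classical in
/-- One step of the chain: stable states are absorbing; in an unstable state a random vertex is
selected and toppled. -/
noncomputable def step [Fintype V] [DecidableEq V] (x : State V S) : PMF (State V S) :=
  if h : N.Stable x.η then PMF.pure x else (N.selectVertex x.η h).bind (N.topple x)

/-- The transition kernel of the chain `(η_n, q_n)`. -/
noncomputable def stepKernel [Fintype V] [DecidableEq V] : Kernel (State V S) (State V S) where
  toFun x := (N.step x).toMeasure
  measurable' := measurable_from_top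

instance [Fintype V] [DecidableEq V] : IsMarkovKernel N.stepKernel :=
  ⟨fun x => PMF.toMeasure.isProbabilityMeasure (N.step x)⟩

/-- The transition kernels as functions of the history up to time `n`, of which only the last
state matters. -/
noncomputable def historyKernel [Fintype V] [DecidableEq V] (n : ℕ) :
    Kernel ((_ : Finset.Iic n) → State V S) (State V S) :=
  N.stepKernel.comap (fun h => h ⟨n, Finset.mem_Iic.2 le_rfl⟩) (measurable_pi_apply _)

instance [Fintype V] [DecidableEq V] (n : ℕ) : IsMarkovKernel (N.historyKernel n) := by
  unfold historyKernel
  infer_instance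

/-- The law, on the space of trajectories, of the Markov chain `(η_n, q_n)` with transition
kernel `stepKernel` started at `(η₀, q₀)`. -/
noncomputable def law [Fintype V] [DecidableEq V] (η₀ : V → ℕ) (q₀ : ∀ v, S v) :
    Measure (ℕ → State V S) :=
  Kernel.traj (X := fun _ => State V S)
    N.historyKernel 0 (fun _ => ⟨fun v => (η₀ v : ℤ), q₀⟩)

/-- The network started at `(η₀, q₀)` stabilizes almost surely. -/
def StabilizesAS [Fintype V] [DecidableEq V] (η₀ : V → ℕ) (q₀ : ∀ v, S v) : Prop :=
  ∀ᵐ ω ∂(N.law η₀ q₀), ∃ n, N.Stable (ω n).η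

/-- The network started at `(η₀, q₀)` fails to stabilize with positive probability. -/
def FailsToStabilize [Fintype V] [DecidableEq V] (η₀ : V → ℕ) (q₀ : ∀ v, S v) : Prop :=
  0 < N.law η₀ q₀ {ω | ∀ n, ¬ N.Stable (ω n).η}

/-- The functions `a` and `φ` form a (nontrivial) conserved quantity: `a` is not identically
zero and, from every initial state, almost surely the quantity
`∑ v, (a(v) η_n(v) + φ(v, q_n(v)))` does not depend on `n`. -/
def IsConserved [Fintype V] [DecidableEq V] (a : V → ℝ) (φ : ∀ v, S v → ℝ) : Prop :=
  a ≠ 0 ∧ ∀ (η₀ : V → ℕ) (q₀ : ∀ v, S v), ∀ᵐ ω ∂(N.law η₀ q₀), ∀ n,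
    ∑ v, (a v * ((ω n).η v : ℝ) + φ v ((ω n).q v)) = ∑ v, (a v * (η₀ v : ℝ) + φ v (q₀ v))

/-! ### Environment chains -/

/-- The transition matrix `P_v` with real entries. -/
noncomputable def envMatrix (v : V) : Matrix (S v) (S v) ℝ := fun s s' => (N.P v s s').toReal

/-- Each environment chain is irreducible and aperiodic: for each state `s`, the greatest common
divisor of the possible return times `n ≥ 1` is `1`. -/
def EnvErgodic [∀ v, Fintype (S v)] [∀ v, DecidableEq (S v)] : Prop :=
  ∀ v, (N.envMatrix v).IsIrreducible ∧
    ∀ s, ∀ d : ℕ, (∀ n, 1 ≤ n → 0 < (N.envMatrix v ^ n) s s → d ∣ n) → d = 1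

/-- `π v` is a stationary probability distribution of `P_v`, for every `v`. -/
def IsStationary [∀ v, Fintype (S v)] (π : ∀ v, S v → ℝ) : Prop :=
  ∀ v, π v ∈ stdSimplex ℝ (S v) ∧ Matrix.vecMul (π v) (N.envMatrix v) = π v

/-! ### Expected topplings -/

/-- Every toppling law has a finite expectation. -/
def HasMeans : Prop :=
  ∀ v s w, Integrable (fun ξ : V → ℤ => (ξ w : ℝ)) (N.ν v s).toMeasure

/-- The expectation `μ^{v,s}` of `ν^{v,s}`. -/
noncomputable def mean (v : V) (s : S v) (w : V) : ℝ :=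
  ∫ ξ : V → ℤ, (ξ w : ℝ) ∂(N.ν v s).toMeasure

/-- The expected toppling matrix `M(v,w) = ∑ s, π_v(s) μ^{v,s}(w)`. -/
noncomputable def toppling [∀ v, Fintype (S v)] (π : ∀ v, S v → ℝ) : Matrix V V ℝ :=
  fun v w => ∑ s, π v s * N.mean v s w

/-! ### Standing assumptions -/

/-- Mass is only lost internally: `ξ^{v,s}(w) ≥ 0` almost surely for `w ≠ v`. -/
def MOLI : Prop := ∀ v s, ∀ ξ ∈ (N.ν v s).support, ∀ w, w ≠ v → 0 ≤ ξ w

/-- Bounded from below: `-ξ^{v,s}(v) ≤ t(v)` almost surely. -/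
def BFB : Prop := ∀ v s, ∀ ξ ∈ (N.ν v s).support, -ξ v ≤ N.t v

end StochasticNetwork

/-- Irreducibility of a toppling matrix: some power of `M - Diag(M)` has positive off-diagonal
entries. -/
def ToppleIrreducible {V : Type*} [Fintype V] [DecidableEq V] (M : Matrix V V ℝ) : Prop :=
  ∃ k : ℕ, ∀ v w, v ≠ w → 0 < ((M - Matrix.diagonal M.diag) ^ k) v w

/-- `α = max_v (-M(v,v)) + 1`. -/
noncomputable def shiftAlpha {V : Type*} (M : Matrix V V ℝ) : ℝ := (⨆ v, -M v v) + 1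

/-- The spectral radius of a real matrix: the largest modulus of a complex eigenvalue (for a
primitive nonnegative matrix, its Perron-Frobenius eigenvalue). -/
noncomputable def matrixRadius {V : Type*} [Fintype V] [DecidableEq V] (A : Matrix V V ℝ) : ℝ :=
  (spectralRadius ℂ (A.map (fun x : ℝ => (x : ℂ)))).toReal

/-- `ρ = r(M + α I) - α`. -/
noncomputable def criticalParam {V : Type*} [Fintype V] [DecidableEq V] (M : Matrix V V ℝ) : ℝ :=
  matrixRadius (M + shiftAlpha M • (1 : Matrix V V ℝ)) - shiftAlpha M

/-! By MOLI the matrix `M` is nonnegative off the diagonal, so Perron–Frobenius theory gives a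
positive vector `a`, unique up to scaling, with `M a = ρ a`. Averaged over stationary environments,
a toppling at `v` changes `∑ a η` by `ρ a(v)`. Solving a Poisson equation for each `P v` yields a
bounded correction `φ` of the environment (`exists_isCorrector`) for which `height a φ` has expected
change exactly `ρ a(v)` in every environment. MOLI and BFB keep configurations nonnegative, so the
height is bounded below there and has finite sublevel sets.

If `ρ < 0`, the height drifts downward uniformly while the state is unstable, and Foster's criterion
(`killed_foster`) gives stabilization. If `ρ > 0`, the function `exp (-θ * height)` is a
supermartingale for some `θ > 0`; stable states have bounded height, so a start of large height
stabilizes with probability less than one.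

If `ρ = 0`, the height is a martingale. Should the chain stay unstable with positive probability,
the maximal inequality and finiteness of sublevel sets produce a state from which it is confined to
finitely many unstable states, hence a recurrent class of such states. A martingale is constant on
that class, and irreducibility makes every kind of toppling occur in it, so no toppling changes the
height: it is conserved (`isConserved_of_not_stabilizesAS`). Conversely, the coefficients of a
conserved quantity lie in the kernel of `M`, hence are a multiple of `a`; a large initial
configuration can then never become stable.

Trajectories enter only through `lintegral_law`, which expresses the probability of being unstable
before time `n` as an iterate of a killed transition operator. -/

namespace PMF

/-! ### Expectations under probability mass functions -/

variable {α β : Type*}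

/-- The expectation of a nonnegative function under a probability mass function. -/
noncomputable def lexp (p : PMF α) (f : α → ℝ≥0∞) : ℝ≥0∞ := ∑' a, p a * f a

theorem lintegral_toMeasure [Countable α] [MeasurableSpace α] [MeasurableSingletonClass α]
    (p : PMF α) (f : α → ℝ≥0∞) : ∫⁻ a, f a ∂p.toMeasure = p.lexp f := by
  rw [lintegral_countable', lexp]
  refine tsum_congr fun a => ?_
  rw [toMeasure_apply_singleton _ _ (measurableSet_singleton a), mul_comm]

theorem ae_toMeasure_iff [Countable α] [MeasurableSpace α] [MeasurableSingletonClass α]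
    (p : PMF α) (Q : α → Prop) : (∀ᵐ a ∂p.toMeasure, Q a) ↔ ∀ a ∈ p.support, Q a := by
  rw [ae_iff, toMeasure_apply_eq_zero_iff _ (Set.to_countable _).measurableSet,
    Set.disjoint_left]
  simp

theorem lexp_mono {p : PMF α} {f g : α → ℝ≥0∞} (h : ∀ a ∈ p.support, f a ≤ g a) :
    p.lexp f ≤ p.lexp g := by
  refine ENNReal.tsum_le_tsum fun a => ?_
  by_cases ha : p a = 0
  · simp [ha]
  · gcongr
    exact h a ha

theorem lexp_congr {p : PMF α} {f g : α → ℝ≥0∞} (h : ∀ a ∈ p.support, f a = g a) :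
    p.lexp f = p.lexp g :=
  le_antisymm (lexp_mono fun a ha => (h a ha).le) (lexp_mono fun a ha => (h a ha).ge)

@[simp] theorem lexp_const (p : PMF α) (c : ℝ≥0∞) : p.lexp (fun _ => c) = c := by
  simp [lexp, ENNReal.tsum_mul_right]

theorem lexp_add (p : PMF α) (f g : α → ℝ≥0∞) :
    p.lexp (fun a => f a + g a) = p.lexp f + p.lexp g := by
  simp [lexp, mul_add, ENNReal.tsum_add]

theorem lexp_const_mul (p : PMF α) (c : ℝ≥0∞) (f : α → ℝ≥0∞) :
    p.lexp (fun a => c * f a) = c * p.lexp f := by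
  simp only [lexp, ← ENNReal.tsum_mul_left]
  exact tsum_congr fun a => by ring

@[simp] theorem lexp_pure (a : α) (f : α → ℝ≥0∞) : (PMF.pure a).lexp f = f a := by
  rw [lexp, tsum_eq_single a]
  · simp
  · intro b hb
    simp [hb]

theorem lexp_bind (p : PMF α) (k : α → PMF β) (f : β → ℝ≥0∞) :
    (p.bind k).lexp f = p.lexp fun a => (k a).lexp f := by
  simp only [lexp, bind_apply, ← ENNReal.tsum_mul_left, ← ENNReal.tsum_mul_right]
  rw [ENNReal.tsum_comm]
  simp only [mul_assoc]

theorem lexp_map (p : PMF α) (k : α → β) (f : β → ℝ≥0∞) :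
    (p.map k).lexp f = p.lexp fun a => f (k a) := by
  simp [map, lexp_bind]

/-- A function bounded by its finite mean is equal to it on the support. -/
theorem eq_of_lexp_eq {p : PMF α} {f : α → ℝ≥0∞} {c : ℝ≥0∞} (hc : c ≠ ∞)
    (hf : ∀ a ∈ p.support, f a ≤ c) (h : c ≤ p.lexp f) : ∀ a ∈ p.support, f a = c := by
  intro a ha
  by_contra hne
  have hlt : f a < c := lt_of_le_of_ne (hf a ha) hne
  have h1 : p.lexp f < p.lexp fun _ => c := by
    refine ENNReal.tsum_lt_tsum (i := a) ?_ ?_ ?_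
    · exact ne_top_of_le_ne_top (b := c) hc ((lexp_mono hf).trans (lexp_const p c).le)
    · intro b
      by_cases hb : p b = 0
      · simp [hb]
      · gcongr
        exact hf b hb
    · exact ENNReal.mul_lt_mul_right ha (p.apply_ne_top a) hlt
  rw [lexp_const] at h1
  exact absurd h h1.not_ge

theorem lexp_eq_zero_iff {p : PMF α} {f : α → ℝ≥0∞} :
    p.lexp f = 0 ↔ ∀ a ∈ p.support, f a = 0 := by
  simp only [lexp, ENNReal.tsum_eq_zero, mul_eq_zero, mem_support_iff]
  exact forall_congr' fun a => by tauto

end PMF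

/-! ### Killed transition operators -/

section Killed

variable {X : Type*} (κ : X → PMF X) {U G : Set X}

/-- The transition operator of a Markov chain killed on leaving `U`. -/
noncomputable def killed (U : Set X) (f : X → ℝ≥0∞) : X → ℝ≥0∞ :=
  U.indicator fun x => (κ x).lexp f

variable {κ}

theorem killed_of_mem {f : X → ℝ≥0∞} {x : X} (hx : x ∈ U) :
    killed κ U f x = (κ x).lexp f := Set.indicator_of_mem hx _

theorem killed_of_notMem {f : X → ℝ≥0∞} {x : X} (hx : x ∉ U) : killed κ U f x = 0 :=
  Set.indicator_of_notMem hx _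

theorem killed_mono {f g : X → ℝ≥0∞} (h : f ≤ g) : killed κ U f ≤ killed κ U g :=
  fun _ => Set.indicator_le_indicator (PMF.lexp_mono fun a _ => h a)

theorem killed_iterate_mono {f g : X → ℝ≥0∞} (h : f ≤ g) (n : ℕ) :
    (killed κ U)^[n] f ≤ (killed κ U)^[n] g :=
  (show Monotone (killed κ U) from fun _ _ => killed_mono).iterate n h

theorem killed_const_mul (c : ℝ≥0∞) (f : X → ℝ≥0∞) :
    killed κ U (fun x => c * f x) = fun x => c * killed κ U f x := by
  funext x
  by_cases hx : x ∈ U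
  · simp only [killed_of_mem hx, PMF.lexp_const_mul]
  · simp only [killed_of_notMem hx, mul_zero]

theorem killed_iterate_const_mul (c : ℝ≥0∞) (f : X → ℝ≥0∞) (n : ℕ) :
    (killed κ U)^[n] (fun x => c * f x) = fun x => c * (killed κ U)^[n] f x := by
  induction n with
  | zero => rfl
  | succ n ih =>
    rw [Function.iterate_succ_apply', ih, killed_const_mul]
    simp only [Function.iterate_succ_apply']

theorem killed_one_le : killed κ U (fun _ => 1) ≤ fun _ => 1 := by
  intro x
  by_cases hx : x ∈ U
  · simp [killed_of_mem hx]
  · simp [killed_of_notMem hx]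

theorem killed_iterate_one_antitone :
    Antitone fun n => (killed κ U)^[n] (fun _ => 1) := by
  refine antitone_nat_of_succ_le fun n => ?_
  rw [Function.iterate_succ_apply]
  exact killed_iterate_mono killed_one_le n

theorem killed_iterate_one_le (n : ℕ) (x : X) : (killed κ U)^[n] (fun _ => 1) x ≤ 1 :=
  killed_iterate_one_antitone (Nat.zero_le n) x

/-- Foster's criterion: a uniform downward drift of `h` on `U` bounds the time spent in `U`. -/
theorem killed_foster (hG : ∀ x ∈ G, ∀ y ∈ (κ x).support, y ∈ G) {h : X → ℝ≥0∞} {c : ℝ≥0∞}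
    (hd : ∀ x ∈ G, x ∈ U → (κ x).lexp h + c ≤ h x) (n : ℕ) :
    ∀ x ∈ G, n * c * (killed κ U)^[n] (fun _ => 1) x ≤ h x := by
  induction n with
  | zero => simp
  | succ n ih =>
    intro x hx
    rw [Function.iterate_succ_apply']
    by_cases hU : x ∈ U
    · rw [killed_of_mem hU]
      refine le_trans ?_ (hd x hx hU)
      set g := (killed κ U)^[n] (fun _ => 1)
      calc ((n + 1 : ℕ) : ℝ≥0∞) * c * (κ x).lexp g
          = (κ x).lexp (fun y => n * c * g y) + c * (κ x).lexp g := by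
            rw [PMF.lexp_const_mul]; push_cast; ring
        _ ≤ (κ x).lexp h + c * 1 := by
            gcongr
            · exact PMF.lexp_mono fun y hy => ih y (hG x hx y hy)
            · refine (PMF.lexp_mono fun y _ => killed_iterate_one_le n y).trans ?_
              simp
        _ = _ := by rw [mul_one]
    · simp [killed_of_notMem hU]

/-- The maximal inequality for a supermartingale `h`. -/
theorem killed_maximal (hG : ∀ x ∈ G, ∀ y ∈ (κ x).support, y ∈ G) {h : X → ℝ≥0∞}
    (hd : ∀ x ∈ G, x ∈ U → (κ x).lexp h ≤ h x) {L : ℝ≥0∞} (hL : L ≠ 0) (hL' : L ≠ ∞) (n : ℕ) :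
    ∀ x ∈ G, (killed κ U)^[n] (fun _ => 1) x ≤
      L⁻¹ * h x + (killed κ {x | x ∈ G ∧ x ∈ U ∧ h x < L})^[n] (fun _ => 1) x := by
  induction n with
  | zero => simp
  | succ n ih =>
    intro x hx
    -- At level `L` or above, the term `L⁻¹ * h x` alone is at least `1`; below it both operators
    -- take the same step.
    by_cases hhL : L ≤ h x
    · refine (killed_iterate_one_le _ x).trans (le_add_right ?_)
      rw [← ENNReal.inv_mul_cancel hL hL']
      gcongr
    · rw [Function.iterate_succ_apply', Function.iterate_succ_apply']
      by_cases hU : x ∈ U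
      · rw [killed_of_mem hU, killed_of_mem (show x ∈ {x | x ∈ G ∧ x ∈ U ∧ h x < L} from
          ⟨hx, hU, not_le.1 hhL⟩)]
        refine (PMF.lexp_mono fun y hy => ih y (hG x hx y hy)).trans ?_
        rw [PMF.lexp_add, PMF.lexp_const_mul]
        gcongr
        exact hd x hx hU
      · simp [killed_of_notMem hU]

/-- If a bounded multiple of `f` dominates `1` off `U` and `f` is superharmonic on `U`, then `f`
bounds the probability of leaving `U`. -/
theorem one_le_killed_add {f : X → ℝ≥0∞} (hG : ∀ x ∈ G, ∀ y ∈ (κ x).support, y ∈ G)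
    (hd : ∀ x ∈ G, x ∈ U → (κ x).lexp f ≤ f x) (hf : ∀ x ∈ G, x ∉ U → 1 ≤ f x) (n : ℕ) :
    ∀ x ∈ G, 1 ≤ (killed κ U)^[n] (fun _ => 1) x + f x := by
  induction n with
  | zero => simp
  | succ n ih =>
    intro x hx
    by_cases hU : x ∈ U
    · rw [Function.iterate_succ_apply', killed_of_mem hU]
      refine le_trans ?_ (add_le_add_right (hd x hx hU) _)
      rw [← PMF.lexp_add]
      exact (PMF.lexp_const (κ x) 1).ge.trans (PMF.lexp_mono fun y hy => ih y (hG x hx y hy))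
    · exact le_add_left (hf x hx hU)

/-- Reachability by transitions of positive probability. -/
def Reach (κ : X → PMF X) : X → X → Prop := Relation.ReflTransGen fun x y => y ∈ (κ x).support

/-- An average of numbers at most `1` equals `1` only if all of them do, so certainty of surviving
forever passes to every possible successor. -/
theorem killed_eq_one_of_reach {x y : X} (hxy : Reach κ x y)
    (h : ∀ n, (killed κ U)^[n] (fun _ => 1) x = 1) :
    ∀ n, (killed κ U)^[n] (fun _ => 1) y = 1 := by
  induction hxy with
  | refl => exact h
  | @tail y z _ hyz ih =>
    intro n
    have h1 := ih (n + 1)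
    rw [Function.iterate_succ_apply'] at h1
    have hy : y ∈ U := by
      by_contra hy
      simp [killed_of_notMem hy] at h1
    rw [killed_of_mem hy] at h1
    exact PMF.eq_of_lexp_eq ENNReal.one_ne_top (fun a _ => killed_iterate_one_le n a) h1.ge z hyz

theorem mem_of_killed_eq_one {x : X} (h : ∀ n, (killed κ U)^[n] (fun _ => 1) x = 1) : x ∈ U := by
  by_contra hx
  have := h 1
  simp [killed_of_notMem hx] at this

/-- A chain leaves a finite set almost surely unless it can be confined to it. -/
theorem killed_tendsto_zero_of_finite (hU : U.Finite)
    (h : ∀ x ∈ U, ∃ n, (killed κ U)^[n] (fun _ => 1) x ≠ 1) :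
    ∀ ε : ℝ≥0∞, ε ≠ 0 → ∃ n, ∀ x, (killed κ U)^[n] (fun _ => 1) x < ε := by
  intro ε hε
  have h' : ∀ x, ∃ n, x ∈ U → (killed κ U)^[n] (fun _ => 1) x ≠ 1 := fun x => by
    by_cases hx : x ∈ U
    · obtain ⟨n, hn⟩ := h x hx
      exact ⟨n, fun _ => hn⟩
    · exact ⟨0, fun hx' => absurd hx' hx⟩
  choose m hm using h'
  obtain ⟨B, hB⟩ := (hU.image m).bddAbove
  -- `B` bounds the chosen times on `U`; the extra step makes the iterate vanish off `U` as well.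
  set K := B + 1
  have hK : ∀ x, (killed κ U)^[K] (fun _ => 1) x < 1 := by
    intro x
    by_cases hx : x ∈ U
    · refine lt_of_le_of_lt (killed_iterate_one_antitone
        (show m x ≤ K from (hB (Set.mem_image_of_mem m hx)).trans (Nat.le_succ B)) x) ?_
      exact lt_of_le_of_ne (killed_iterate_one_le _ x) (hm x hx)
    · simp [K, Function.iterate_succ_apply', killed_of_notMem hx]
  obtain ⟨δ, hδ1, hδ⟩ : ∃ δ : ℝ≥0∞, δ < 1 ∧ ∀ x, (killed κ U)^[K] (fun _ => 1) x ≤ δ := by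
    refine ⟨hU.toFinset.sup fun x => (killed κ U)^[K] (fun _ => 1) x, ?_, fun x => ?_⟩
    · rw [Finset.sup_lt_iff (by simp)]
      exact fun x _ => hK x
    · by_cases hx : x ∈ U
      · exact Finset.le_sup (f := fun x => (killed κ U)^[K] (fun _ => 1) x) (by simpa using hx)
      · simp [K, Function.iterate_succ_apply', killed_of_notMem hx]
  -- Each block of `K` steps is survived with probability at most `δ`, wherever it starts.
  have hpow : ∀ j, ∀ x, (killed κ U)^[K * j] (fun _ => 1) x ≤ δ ^ j := by
    intro j
    induction j with
    | zero => simp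
    | succ j ih =>
      intro x
      rw [Nat.mul_succ, add_comm, Function.iterate_add_apply]
      have h1 : (killed κ U)^[K] ((killed κ U)^[K * j] fun _ => 1) x ≤
          (killed κ U)^[K] (fun _ => δ ^ j * 1) x :=
        killed_iterate_mono (fun y => by simpa using ih y) K x
      refine h1.trans ?_
      rw [killed_iterate_const_mul, pow_succ]
      exact mul_le_mul_right (hδ x) _
  obtain ⟨j, hj⟩ := ((ENNReal.tendsto_pow_atTop_nhds_zero_of_lt_one hδ1).eventually
    (gt_mem_nhds (pos_iff_ne_zero.2 hε))).exists
  exact ⟨K * j, fun x => (hpow j x).trans_lt hj⟩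

/-- Among the states reachable from `x`, if finitely many, there is one in a closed strongly
connected class. -/
theorem exists_reach_recurrent {x : X} (hfin : {y | Reach κ x y}.Finite) :
    ∃ y, Reach κ x y ∧ ∀ z, Reach κ y z → Reach κ z y := by
  -- A reachable `y` with the fewest reachable states works: any `z` beyond it reaches a subset of
  -- the same size, hence reaches `y`.
  obtain ⟨y, hy, hmin⟩ := hfin.exists_minimalFor (fun y => {z | Reach κ y z}.ncard) _
    ⟨x, Relation.ReflTransGen.refl⟩
  refine ⟨y, hy, fun z hz => ?_⟩
  have hyfin : {w | Reach κ y w}.Finite := hfin.subset fun w hw => hy.trans hw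
  have hsub : {w | Reach κ z w} ⊆ {w | Reach κ y w} := fun w hw => hz.trans hw
  have hle : {w | Reach κ y w}.ncard ≤ {w | Reach κ z w}.ncard :=
    hmin (show Reach κ x z from hy.trans hz) (Set.ncard_le_ncard hsub hyfin)
  have := Set.eq_of_subset_of_ncard_le hsub hle hyfin
  exact this.ge (show Reach κ y y from Relation.ReflTransGen.refl)

/-- Maximum principle on a finite closed strongly connected class. -/
theorem harmonic_const_of_recurrent {y : X} (hfin : {z | Reach κ y z}.Finite)
    (hrec : ∀ z, Reach κ y z → Reach κ z y) {h : X → ℝ≥0∞} (hh : ∀ z, Reach κ y z → h z ≠ ∞)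
    (hharm : ∀ z, Reach κ y z → (κ z).lexp h = h z) : ∀ z, Reach κ y z → h z = h y := by
  obtain ⟨z₀, hz₀, hmax⟩ := hfin.exists_maximalFor h _ ⟨y, Relation.ReflTransGen.refl⟩
  have hmax' : ∀ z, Reach κ y z → h z ≤ h z₀ := fun z hz => by
    rcases le_total (h z) (h z₀) with h1 | h1
    · exact h1
    · exact hmax hz h1
  have key : ∀ z, Reach κ z₀ z → h z = h z₀ := by
    intro z hz
    induction hz with
    | refl => rfl
    | @tail z w hz hzw ih =>
      have hyz : Reach κ y z := Relation.ReflTransGen.trans hz₀ hz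
      exact PMF.eq_of_lexp_eq (hh z₀ hz₀) (fun a ha => hmax' a (hyz.tail ha))
        (by rw [hharm z hyz, ih]) w hzw
  intro z hz
  rw [key z ((hrec z₀ hz₀).trans hz), key y (hrec z₀ hz₀)]

end Killed

/-! ### Trajectory law and killed operators -/

namespace StochasticNetwork

variable {V : Type*} {S : V → Type*} (N : StochasticNetwork V S)

instance [Finite V] [∀ v, Finite (S v)] : Countable (State V S) := by
  refine Function.Injective.countable (f := fun x : State V S => (x.η, x.q)) ?_
  rintro ⟨η, q⟩ ⟨η', q'⟩ h
  simpa using h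

instance : DiscreteMeasurableSpace (State V S) := ⟨fun _ => trivial⟩

variable [Fintype V] [DecidableEq V] [∀ v, Fintype (S v)]

instance (η₀ : V → ℕ) (q₀ : ∀ v, S v) : IsProbabilityMeasure (N.law η₀ q₀) := by
  unfold law
  infer_instance

/-- Along the trajectory, the killed operators compute expectations. -/
theorem lintegral_law (η₀ : V → ℕ) (q₀ : ∀ v, S v) (U : Set (State V S)) (m : ℕ)
    (f : State V S → ℝ≥0∞) :
    ∫⁻ ω, {ω : ℕ → State V S | ∀ k < m, ω k ∈ U}.indicator (fun ω => f (ω m)) ω ∂N.law η₀ q₀ =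
      (killed N.step U)^[m] f ⟨fun v => η₀ v, q₀⟩ := by
  have hmeas : ∀ (m : ℕ), MeasurableSet {ω : ℕ → State V S | ∀ k < m, ω k ∈ U} := fun m => by
    simp only [Set.ofPred_forall]
    exact MeasurableSet.iInter fun k => MeasurableSet.iInter fun _ =>
      measurable_pi_apply k (MeasurableSet.of_discrete (s := U))
  have hmf : ∀ (m : ℕ) (f : State V S → ℝ≥0∞), Measurable fun ω : ℕ → State V S => f (ω m) :=
    fun m f => (Measurable.of_discrete (f := f)).comp (measurable_pi_apply m)
  induction m generalizing f with
  | zero =>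
    simp only [not_lt_zero, IsEmpty.forall_iff, implies_true, Set.ofPred_true,
      Set.indicator_univ, Function.iterate_zero, id]
    rw [law, Kernel.lintegral_traj _ (hmf 0 f)]
    simp [Function.updateFinset]
  | succ m ih =>
    rw [Function.iterate_succ_apply, ← ih]
    unfold law
    set x₀ : (_ : Finset.Iic 0) → State V S := fun _ => ⟨fun v => η₀ v, q₀⟩
    -- Conditioning on the first `m` steps: keep the past of `ω` and resample the continuation `ω'`
    -- given that past.
    have key : ∀ F : (ℕ → State V S) → ℝ≥0∞, Measurable F →
        ∫⁻ ω, F ω ∂Kernel.traj (X := fun _ => State V S) N.historyKernel 0 x₀ =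
        ∫⁻ ω, (∫⁻ ω', F (Function.updateFinset ω' (Finset.Iic m)
            (Preorder.frestrictLe m ω)) ∂Kernel.traj (X := fun _ => State V S)
              N.historyKernel m (Preorder.frestrictLe m ω))
          ∂Kernel.traj (X := fun _ => State V S) N.historyKernel 0 x₀ := by
      intro F hF
      conv_lhs => rw [← Kernel.traj_comp_partialTraj (Nat.zero_le m),
        Kernel.lintegral_comp _ _ _ hF,
        ← Kernel.traj_map_frestrictLe_apply, lintegral_map hF.lintegral_kernel (by fun_prop)]
      refine lintegral_congr fun ω => ?_
      rw [Kernel.lintegral_traj _ hF]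
    rw [key _ ((hmf (m + 1) f).indicator (hmeas (m + 1)))]
    refine lintegral_congr fun ω => ?_
    have h1 : ∀ ω', {ω : ℕ → State V S | ∀ k < m + 1, ω k ∈ U}.indicator (fun ω => f (ω (m + 1)))
        (Function.updateFinset ω' (Finset.Iic m) (Preorder.frestrictLe m ω)) =
        {ω : ℕ → State V S | ∀ k < m + 1, ω k ∈ U}.indicator (fun _ => f (ω' (m + 1))) ω := by
      intro ω'
      have : ∀ k < m + 1, Function.updateFinset ω' (Finset.Iic m) (Preorder.frestrictLe m ω) k
          = ω k := fun k hk => by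
        simp [Function.updateFinset, Nat.lt_succ_iff.1 hk]
      have h2 : Function.updateFinset ω' (Finset.Iic m) (Preorder.frestrictLe m ω) (m + 1)
          = ω' (m + 1) := by
        simp [Function.updateFinset]
      simp only [Set.indicator, Set.mem_ofPred_eq, h2]
      congr 1
      exact propext (forall₂_congr fun k hk => by rw [this k hk])
    simp only [h1]
    by_cases hω : ∀ k < m + 1, ω k ∈ U
    · rw [Set.indicator_of_mem (show ω ∈ {ω : ℕ → State V S | ∀ k < m, ω k ∈ U} from
        fun k hk => hω k (by omega)), killed_of_mem (hω m (by omega))]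
      simp only [Set.indicator_of_mem
        (show ω ∈ {ω : ℕ → State V S | ∀ k < m + 1, ω k ∈ U} from hω)]
      rw [← PMF.lintegral_toMeasure]
      have h3 := Kernel.map_traj_succ_self (X := fun _ => State V S) (κ := N.historyKernel) (a := m)
      have h4 := congrArg (fun K => K (Preorder.frestrictLe m ω)) h3
      rw [Kernel.map_apply _ (measurable_pi_apply _)] at h4
      have h5 : N.historyKernel m (Preorder.frestrictLe m ω) = (N.step (ω m)).toMeasure := rfl
      rw [← h5, ← h4, lintegral_map (Measurable.of_discrete) (measurable_pi_apply _)]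
    · simp only [Set.indicator_of_notMem
        (show ω ∉ {ω : ℕ → State V S | ∀ k < m + 1, ω k ∈ U} from hω)]
      rw [lintegral_zero]
      by_cases hω' : ∀ k < m, ω k ∈ U
      · rw [Set.indicator_of_mem (show ω ∈ {ω : ℕ → State V S | ∀ k < m, ω k ∈ U} from hω'),
          killed_of_notMem]
        intro hm
        refine hω fun k hk => ?_
        rcases Nat.lt_succ_iff_lt_or_eq.1 hk with h | rfl
        · exact hω' k h
        · exact hm
      · rw [Set.indicator_of_notMem (show ω ∉ {ω : ℕ → State V S | ∀ k < m, ω k ∈ U} from hω')]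

end StochasticNetwork

/-! ### Irreducible stochastic matrices and the Poisson equation -/

/-- A nonempty set of indices closed under the positive entries of an irreducible matrix is
everything. -/
theorem Matrix.IsIrreducible.mem_of_closed {n : Type*} {A : Matrix n n ℝ} (hA : A.IsIrreducible)
    {T : Set n} {i : n} (hi : i ∈ T) (hT : ∀ i ∈ T, ∀ j, 0 < A i j → j ∈ T) (j : n) : j ∈ T := by
  let : Quiver n := A.toQuiver
  obtain ⟨p, -⟩ := hA.connected i j
  induction p with
  | nil => exact hi
  | cons p e ih => exact hT _ ih _ e.down

/-- Functions harmonic for an irreducible stochastic matrix are constant. -/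
theorem Matrix.IsIrreducible.const_of_harmonic {n : Type*} [Fintype n] {P : Matrix n n ℝ}
    (hP : P.IsIrreducible) (hrow : ∀ i, ∑ j, P i j = 1) {φ : n → ℝ} (hφ : P.mulVec φ = φ)
    (i j : n) : φ i = φ j := by
  obtain ⟨m, -, hm⟩ := Finset.exists_max_image Finset.univ φ ⟨i, Finset.mem_univ i⟩
  -- Maximum principle: at a maximizer the nonnegative gaps `φ m - φ j` average to zero, so every
  -- successor is a maximizer too.
  have key : ∀ j, j ∈ {j | φ j = φ m} := by
    refine hP.mem_of_closed (i := m) rfl fun s (hs : φ s = φ m) t hst => ?_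
    have h1 : ∑ j, P s j * (φ m - φ j) = 0 := by
      have h2 := congrFun hφ s
      simp only [Matrix.mulVec, dotProduct] at h2
      simp only [mul_sub, Finset.sum_sub_distrib, ← Finset.sum_mul, hrow, h2, hs]
      ring
    have h3 := (Finset.sum_eq_zero_iff_of_nonneg fun j _ =>
      mul_nonneg (hP.nonneg s j) (sub_nonneg.2 (hm j (Finset.mem_univ j)))).1 h1 t
        (Finset.mem_univ t)
    rcases mul_eq_zero.1 h3 with h | h
    · exact absurd h hst.ne'
    · exact (sub_eq_zero.1 h).symm
  have hi : φ i = φ m := key i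
  have hj : φ j = φ m := key j
  rw [hi, hj]

/-- The Poisson equation of an irreducible stochastic matrix is solvable for functions of mean
zero under the stationary distribution. -/
theorem Matrix.IsIrreducible.exists_poisson {n : Type*} [Fintype n] {P : Matrix n n ℝ}
    (hP : P.IsIrreducible) (hrow : ∀ i, ∑ j, P i j = 1) {π : n → ℝ} (hπ : P.vecMul π = π)
    (hπ1 : ∑ i, π i = 1) {f : n → ℝ} (hf : ∑ i, π i * f i = 0) :
    ∃ φ : n → ℝ, φ - P.mulVec φ = f := by
  classical
  let L : (n → ℝ) →ₗ[ℝ] (n → ℝ) := LinearMap.id - P.mulVecLin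
  let ℓ : (n → ℝ) →ₗ[ℝ] ℝ := dotProductBilin ℝ ℝ π
  have hℓ : ∀ x, ℓ x = ∑ i, π i * x i := fun x => rfl
  have hle : LinearMap.range L ≤ LinearMap.ker ℓ := by
    rintro _ ⟨φ, rfl⟩
    rw [LinearMap.mem_ker]
    change π ⬝ᵥ (φ - P.mulVec φ) = 0
    rw [dotProduct_sub, Matrix.dotProduct_mulVec, hπ, sub_self]
  -- The kernel contains only constants, so by rank–nullity the range of `L` has codimension at most
  -- one and the inclusion `hle` is an equality.
  have hker : LinearMap.ker L ≤ Submodule.span ℝ {fun _ => (1 : ℝ)} := by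
    intro φ hφ
    have h1 : P.mulVec φ = φ := (sub_eq_zero.1 (LinearMap.mem_ker.1 hφ)).symm
    rw [Submodule.mem_span_singleton]
    rcases isEmpty_or_nonempty n with h | ⟨⟨i⟩⟩
    · exact ⟨0, Subsingleton.elim _ _⟩
    · exact ⟨φ i, funext fun j => by simpa using hP.const_of_harmonic hrow h1 i j⟩
  have hk1 : Module.finrank ℝ (LinearMap.ker L) ≤ 1 :=
    (Submodule.finrank_mono hker).trans ((finrank_span_le_card _).trans (by simp))
  have hrn := LinearMap.finrank_range_add_finrank_ker L
  have hrn' := LinearMap.finrank_range_add_finrank_ker ℓ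
  have hsurj : LinearMap.range ℓ = ⊤ := by
    rw [LinearMap.range_eq_top]
    intro c
    refine ⟨fun _ => c, ?_⟩
    rw [hℓ, ← Finset.sum_mul, hπ1, one_mul]
  rw [hsurj, finrank_top, Module.finrank_self] at hrn'
  have heq : LinearMap.range L = LinearMap.ker ℓ :=
    Submodule.eq_of_le_of_finrank_le hle (by omega)
  have hfm : f ∈ LinearMap.range L := by
    rw [heq, LinearMap.mem_ker, hℓ, hf]
  exact hfm

/-! ### Perron-Frobenius theory -/

section Perron

variable {V : Type*} [Fintype V] [DecidableEq V]

omit [DecidableEq V] in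
theorem mulVec_pos_of_pos {B : Matrix V V ℝ} (hB : ∀ i j, 0 < B i j) {y : V → ℝ} (hy : 0 ≤ y)
    (hy0 : y ≠ 0) (i : V) : 0 < B.mulVec y i := by
  obtain ⟨j, hj⟩ := Function.ne_iff.1 hy0
  exact Finset.sum_pos' (fun j _ => mul_nonneg (hB i j).le (hy j))
    ⟨j, Finset.mem_univ j, mul_pos (hB i j) (lt_of_le_of_ne (hy j) (Ne.symm hj))⟩

/-- A nonnegative matrix with a positive power has a positive eigenvector. -/
theorem exists_pos_eigenvector [Nonempty V] {A : Matrix V V ℝ} (hA : ∀ i j, 0 ≤ A i j) {k : ℕ}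
    (hk : ∀ i j, 0 < (A ^ k) i j) :
    ∃ (r : ℝ) (a : V → ℝ), 0 ≤ r ∧ (∀ v, 0 < a v) ∧ A.mulVec a = r • a := by
  -- Collatz–Wielandt: the eigenvalue is the largest `r` with `r x ≤ A x` for some `x` in the
  -- simplex. The bound `C` on such `r` makes `K` compact.
  set C : ℝ := ∑ i, ∑ j, A i j
  let K : Set ((V → ℝ) × ℝ) :=
    {p | p.1 ∈ stdSimplex ℝ V ∧ p.2 ∈ Set.Icc 0 C ∧ ∀ i, p.2 * p.1 i ≤ A.mulVec p.1 i}
  have hcont : ∀ i, Continuous fun p : (V → ℝ) × ℝ => A.mulVec p.1 i := fun i => by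
    simp only [Matrix.mulVec, dotProduct]
    fun_prop
  have hK : IsCompact K := by
    refine IsCompact.of_isClosed_subset ((isCompact_stdSimplex ℝ V).prod
      (isCompact_Icc (a := 0) (b := C))) ?_ fun p hp => ⟨hp.1, hp.2.1⟩
    refine ((isClosed_stdSimplex ℝ V).preimage continuous_fst).inter
      ((isClosed_Icc.preimage continuous_snd).inter ?_)
    have : IsClosed (⋂ i, {p : (V → ℝ) × ℝ | p.2 * p.1 i ≤ A.mulVec p.1 i}) :=
      isClosed_iInter fun i => isClosed_le (by fun_prop) (hcont i)
    have heq : (⋂ i, {p : (V → ℝ) × ℝ | p.2 * p.1 i ≤ A.mulVec p.1 i}) =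
        {p | ∀ i, p.2 * p.1 i ≤ A.mulVec p.1 i} := by
      ext p
      simp
    rw [heq] at this
    exact this
  have hC : ∀ {x : V → ℝ} {l : ℝ}, x ∈ stdSimplex ℝ V → (∀ i, l * x i ≤ A.mulVec x i) →
      l ≤ C := by
    intro x l hx h
    calc l = ∑ i, l * x i := by rw [← Finset.mul_sum, hx.2, mul_one]
      _ ≤ ∑ i, A.mulVec x i := Finset.sum_le_sum fun i _ => h i
      _ ≤ C := Finset.sum_le_sum fun i _ => Finset.sum_le_sum fun j _ =>
          mul_le_of_le_one_right (hA i j)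
            ((Finset.single_le_sum (fun j _ => hx.1 j) (Finset.mem_univ j)).trans hx.2.le)
  have hC0 : 0 ≤ C := Finset.sum_nonneg fun i _ => Finset.sum_nonneg fun j _ => hA i j
  obtain ⟨i₀⟩ := ‹Nonempty V›
  have hne : K.Nonempty := by
    refine ⟨(Pi.single i₀ 1, 0), single_mem_stdSimplex ℝ i₀, ⟨le_rfl, hC0⟩, fun i => ?_⟩
    rw [zero_mul]
    exact Finset.sum_nonneg fun j _ => mul_nonneg (hA i j)
      ((single_mem_stdSimplex ℝ i₀).1 j)
  obtain ⟨⟨x, r⟩, ⟨hx, hr, hxr⟩, hmax⟩ := hK.exists_isMaxOn hne continuous_snd.continuousOn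
  have hx0 : x ≠ 0 := by
    rintro rfl
    simpa using hx.2
  have hzpos : ∀ i, 0 < (A ^ k).mulVec x i := mulVec_pos_of_pos hk hx.1 hx0
  have heig : A.mulVec x = r • x := by
    by_contra hne
    have hy : 0 ≤ A.mulVec x - r • x := fun i => sub_nonneg.2 (hxr i)
    have hypos := mulVec_pos_of_pos hk hy (sub_ne_zero.2 hne)
    set z := (A ^ k).mulVec x
    have hcomm : (A ^ k).mulVec (A.mulVec x - r • x) = A.mulVec z - r • z := by
      rw [Matrix.mulVec_sub, Matrix.mulVec_smul, Matrix.mulVec_mulVec, Matrix.mulVec_mulVec,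
        ← pow_succ, ← pow_succ']
    rw [hcomm] at hypos
    obtain ⟨m, -, hm⟩ := Finset.exists_min_image Finset.univ
      (fun i => (A.mulVec z i - r * z i) / z i) ⟨i₀, Finset.mem_univ i₀⟩
    set ε := (A.mulVec z m - r * z m) / z m
    have hε : 0 < ε := div_pos (hypos m) (hzpos m)
    have hsum : 0 < ∑ i, z i := Finset.sum_pos (fun i _ => hzpos i) ⟨i₀, Finset.mem_univ i₀⟩
    have hmem : (∑ i, z i)⁻¹ • z ∈ stdSimplex ℝ V := by
      refine ⟨fun i => ?_, ?_⟩
      · exact mul_nonneg (inv_nonneg.2 hsum.le) (hzpos i).le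
      · simp only [Pi.smul_apply, smul_eq_mul, ← Finset.mul_sum]
        exact inv_mul_cancel₀ hsum.ne'
    have hineq : ∀ i, (r + ε) * ((∑ i, z i)⁻¹ • z) i ≤ A.mulVec ((∑ i, z i)⁻¹ • z) i := by
      intro i
      have h1 := (le_div_iff₀ (hzpos i)).1 (hm i (Finset.mem_univ i))
      rw [Matrix.mulVec_smul]
      simp only [Pi.smul_apply, smul_eq_mul]
      rw [mul_left_comm]
      refine mul_le_mul_of_nonneg_left ?_ (inv_nonneg.2 hsum.le)
      linarith
    have h2 := hmax (show ((∑ i, z i)⁻¹ • z, r + ε) ∈ K from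
      ⟨hmem, ⟨by linarith [hr.1], hC hmem hineq⟩, hineq⟩)
    simp only [Set.mem_ofPred_eq] at h2
    linarith
  have hpow : ∀ j, (A ^ j).mulVec x = r ^ j • x := by
    intro j
    induction j with
    | zero => simp
    | succ j ih =>
      rw [pow_succ, ← Matrix.mulVec_mulVec, heig, Matrix.mulVec_smul, ih, smul_smul, pow_succ,
        mul_comm]
  refine ⟨r, x, hr.1, fun v => ?_, heig⟩
  have := hzpos v
  rw [hpow k] at this
  exact pos_of_mul_pos_right this (pow_nonneg hr.1 k)

/-- The eigenvalue of a positive eigenvector of a nonnegative matrix is its spectral radius. -/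
theorem matrixRadius_eq [Nonempty V] {A : Matrix V V ℝ} (hA : ∀ i j, 0 ≤ A i j) {r : ℝ}
    {a : V → ℝ} (hr : 0 ≤ r) (ha : ∀ v, 0 < a v) (hAa : A.mulVec a = r • a) :
    matrixRadius A = r := by
  set Ac : Matrix V V ℂ := A.map (fun x : ℝ => (x : ℂ))
  have hspec : ∀ μ : ℂ, μ ∈ spectrum ℂ Ac ↔ ∃ z : V → ℂ, z ≠ 0 ∧ Ac.mulVec z = μ • z := by
    intro μ
    rw [← Matrix.spectrum_toLin', ← Module.End.hasEigenvalue_iff_mem_spectrum]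
    constructor
    · intro h
      obtain ⟨z, hz⟩ := h.exists_hasEigenvector
      exact ⟨z, hz.2, by simpa using hz.apply_eq_smul⟩
    · rintro ⟨z, hz, h⟩
      exact Module.End.hasEigenvalue_of_hasEigenvector (x := z)
        ⟨Module.End.mem_eigenspace_iff.2 (by simpa using h), hz⟩
  have hrs : (r : ℂ) ∈ spectrum ℂ Ac := by
    obtain ⟨i₀⟩ := ‹Nonempty V›
    refine (hspec r).2 ⟨fun v => (a v : ℂ), fun h => ?_, ?_⟩
    · have := congrFun h i₀
      simp only [Pi.zero_apply, Complex.ofReal_eq_zero] at this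
      exact (ha i₀).ne' this
    · funext i
      have := congrFun hAa i
      simp only [Matrix.mulVec, dotProduct, Pi.smul_apply, smul_eq_mul, Ac, Matrix.map_apply]
        at this ⊢
      exact_mod_cast this
  -- Evaluate the eigenvalue equation where `‖z i‖ / a i` is largest, bounding the other coordinates
  -- by that ratio times `a`.
  have hle : ∀ μ ∈ spectrum ℂ Ac, ‖μ‖ ≤ r := by
    intro μ hμ
    obtain ⟨z, hz, hμz⟩ := (hspec μ).1 hμ
    obtain ⟨j, hj⟩ := Function.ne_iff.1 hz
    obtain ⟨m, -, hm⟩ := Finset.exists_max_image Finset.univ (fun i => ‖z i‖ / a i)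
      ⟨j, Finset.mem_univ j⟩
    have hc : 0 < ‖z m‖ / a m :=
      (div_pos (norm_pos_iff.2 hj) (ha j)).trans_le (hm j (Finset.mem_univ j))
    have hzm : ‖z m‖ = ‖z m‖ / a m * a m := by rw [div_mul_cancel₀ _ (ha m).ne']
    have h1 : ‖μ‖ * ‖z m‖ ≤ r * ‖z m‖ := by
      have h2 := congrFun hμz m
      have h3 := congrFun hAa m
      simp only [Matrix.mulVec, dotProduct, Pi.smul_apply, smul_eq_mul, Ac, Matrix.map_apply]
        at h2 h3
      rw [← norm_mul, ← h2]
      calc ‖∑ j, (A m j : ℂ) * z j‖ ≤ ∑ j, ‖(A m j : ℂ) * z j‖ := norm_sum_le _ _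
        _ ≤ ∑ j, A m j * (‖z m‖ / a m * a j) := by
            refine Finset.sum_le_sum fun j _ => ?_
            rw [norm_mul, Complex.norm_real, Real.norm_of_nonneg (hA m j)]
            exact mul_le_mul_of_nonneg_left ((div_le_iff₀ (ha j)).1 (hm j (Finset.mem_univ j)))
              (hA m j)
        _ = ‖z m‖ / a m * ∑ j, A m j * a j := by
            rw [Finset.mul_sum]
            exact Finset.sum_congr rfl fun j _ => by ring
        _ = r * ‖z m‖ := by rw [h3, hzm]; field_simp
    refine le_of_mul_le_mul_right h1 ?_
    rw [hzm]
    exact mul_pos hc (ha m)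
  have : spectralRadius ℂ Ac = ENNReal.ofReal r := by
    refine le_antisymm (iSup₂_le fun μ hμ => ?_) ?_
    · rw [← enorm_eq_nnnorm, ← ofReal_norm]
      exact ENNReal.ofReal_le_ofReal (hle μ hμ)
    · refine le_trans ?_ (le_iSup₂ (f := fun (μ : ℂ) (_ : μ ∈ spectrum ℂ Ac) => (‖μ‖₊ : ℝ≥0∞))
        (r : ℂ) hrs)
      rw [← enorm_eq_nnnorm, ← ofReal_norm, Complex.norm_real, Real.norm_of_nonneg hr]
  rw [matrixRadius, this, ENNReal.toReal_ofReal hr]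

/-- The Perron-Frobenius eigenvalue is geometrically simple. -/
theorem eigenvector_unique [Nonempty V] {A : Matrix V V ℝ} {k : ℕ}
    (hk : ∀ i j, 0 < (A ^ k) i j) {r : ℝ} {a b : V → ℝ} (ha : ∀ v, 0 < a v)
    (hAa : A.mulVec a = r • a) (hAb : A.mulVec b = r • b) : ∃ c : ℝ, b = c • a := by
  obtain ⟨i₀⟩ := ‹Nonempty V›
  obtain ⟨m, -, hm⟩ := Finset.exists_min_image Finset.univ (fun i => b i / a i)
    ⟨i₀, Finset.mem_univ i₀⟩
  -- Subtracting the largest multiple of `a` below `b` leaves a nonnegative eigenvector vanishing at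
  -- `m`; positivity of `A ^ k` forces it to be zero.
  refine ⟨b m / a m, ?_⟩
  set y := b - (b m / a m) • a
  have hAy : A.mulVec y = r • y := by
    rw [Matrix.mulVec_sub, Matrix.mulVec_smul, hAa, hAb, smul_sub, smul_comm]
  have hpow : ∀ j, (A ^ j).mulVec y = r ^ j • y := by
    intro j
    induction j with
    | zero => simp
    | succ j ih =>
      rw [pow_succ, ← Matrix.mulVec_mulVec, hAy, Matrix.mulVec_smul, ih, smul_smul, pow_succ,
        mul_comm]
  have hy : 0 ≤ y := fun i => sub_nonneg.2 ((le_div_iff₀ (ha i)).1 (hm i (Finset.mem_univ i)))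
  have hym : y m = 0 := by
    simp [y, div_mul_cancel₀ _ (ha m).ne']
  by_contra hne
  have h1 := mulVec_pos_of_pos hk hy (sub_ne_zero.2 hne) m
  rw [hpow k] at h1
  simp [hym] at h1

theorem pow_entry_le_pow_entry {A B : Matrix V V ℝ} (hA : ∀ i j, 0 ≤ A i j)
    (hAB : ∀ i j, A i j ≤ B i j) (k : ℕ) : ∀ i j, 0 ≤ (A ^ k) i j ∧ (A ^ k) i j ≤ (B ^ k) i j := by
  induction k with
  | zero =>
    intro i j
    simp only [pow_zero, le_refl, and_true]
    rw [Matrix.one_apply]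
    split_ifs <;> norm_num
  | succ k ih =>
    intro i j
    rw [pow_succ, pow_succ, Matrix.mul_apply, Matrix.mul_apply]
    exact ⟨Finset.sum_nonneg fun l _ => mul_nonneg (ih i l).1 (hA l j),
      Finset.sum_le_sum fun l _ => mul_le_mul (ih i l).2 (hAB l j) (hA l j)
        ((ih i l).1.trans (ih i l).2)⟩

variable {M : Matrix V V ℝ}

omit [DecidableEq V] in
theorem one_le_diag_add_shiftAlpha (M : Matrix V V ℝ) (v : V) : 1 ≤ M v v + shiftAlpha M := by
  have : -M v v ≤ ⨆ v, -M v v := le_ciSup (f := fun v => -M v v) (Set.finite_range _).bddAbove v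
  rw [shiftAlpha]
  linarith

omit [Fintype V] in
theorem off_diag_nonneg (hM : ∀ v w, w ≠ v → 0 ≤ M v w) (i j : V) :
    0 ≤ (M - Matrix.diagonal M.diag) i j := by
  rcases eq_or_ne i j with rfl | h
  · simp
  · simpa [Matrix.diagonal_apply_ne _ h] using hM i j h.symm

theorem shifted_nonneg (hM : ∀ v w, w ≠ v → 0 ≤ M v w) (i j : V) :
    0 ≤ (M + shiftAlpha M • (1 : Matrix V V ℝ)) i j := by
  rcases eq_or_ne i j with rfl | h
  · simpa using zero_le_one.trans (one_le_diag_add_shiftAlpha M i)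
  · simpa [Matrix.one_apply_ne h] using hM i j h.symm

/-- The shifted matrix dominates both `M - Diag(M)` and, because the shift makes its diagonal at
least `1`, the identity. One exponent therefore serves for all entries. -/
theorem exists_shifted_pow_pos (hM : ∀ v w, w ≠ v → 0 ≤ M v w) (hI : ToppleIrreducible M) :
    ∃ k, ∀ i j, 0 < ((M + shiftAlpha M • (1 : Matrix V V ℝ)) ^ k) i j := by
  obtain ⟨k, hk⟩ := hI
  refine ⟨k, fun i j => ?_⟩
  rcases eq_or_ne i j with rfl | h
  · have h1 := (pow_entry_le_pow_entry (A := 1) (B := M + shiftAlpha M • (1 : Matrix V V ℝ))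
      (fun i j => by rw [Matrix.one_apply]; split_ifs <;> norm_num) (fun i j => ?_) k i i).2
    · rw [one_pow, Matrix.one_apply_eq] at h1
      exact zero_lt_one.trans_le h1
    · rcases eq_or_ne i j with rfl | h
      · simpa using one_le_diag_add_shiftAlpha M i
      · simpa [Matrix.one_apply_ne h] using hM i j h.symm
  · refine (hk i j h).trans_le (pow_entry_le_pow_entry (off_diag_nonneg hM) (fun i j => ?_) k i j).2
    rcases eq_or_ne i j with rfl | h
    · simpa using zero_le_one.trans (one_le_diag_add_shiftAlpha M i)
    · simp [Matrix.one_apply_ne h, Matrix.diagonal_apply_ne _ h]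

/-- The matrix `M` has a positive right eigenvector for the critical parameter, and it is the only
one up to scaling. -/
theorem exists_critical_eigenvector [Nonempty V] (hM : ∀ v w, w ≠ v → 0 ≤ M v w)
    (hI : ToppleIrreducible M) :
    ∃ a : V → ℝ, (∀ v, 0 < a v) ∧ M.mulVec a = criticalParam M • a ∧
      ∀ b : V → ℝ, M.mulVec b = criticalParam M • b → ∃ c : ℝ, b = c • a := by
  obtain ⟨k, hk⟩ := exists_shifted_pow_pos hM hI
  obtain ⟨r, a, hr, ha, hAa⟩ := exists_pos_eigenvector (shifted_nonneg hM) hk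
  have hrad := matrixRadius_eq (shifted_nonneg hM) hr ha hAa
  have hiff : ∀ b : V → ℝ, M.mulVec b = criticalParam M • b ↔
      (M + shiftAlpha M • (1 : Matrix V V ℝ)).mulVec b = r • b := by
    intro b
    rw [criticalParam, hrad, Matrix.add_mulVec, Matrix.smul_mulVec, Matrix.one_mulVec, sub_smul,
      eq_sub_iff_add_eq]
  exact ⟨a, ha, (hiff a).2 hAa, fun b hb => eigenvector_unique hk ha hAa ((hiff b).1 hb)⟩

/-- A nonempty set of vertices closed under positive entries of an irreducible `M` is
everything. -/
theorem ToppleIrreducible.mem_of_closed (hM : ∀ v w, w ≠ v → 0 ≤ M v w) (hI : ToppleIrreducible M)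
    {T : Set V} {v : V} (hv : v ∈ T) (hT : ∀ v ∈ T, ∀ w, w ≠ v → 0 < M v w → w ∈ T) (w : V) :
    w ∈ T := by
  obtain ⟨k, hk⟩ := hI
  have key : ∀ (j : ℕ) (w : V), 0 < ((M - Matrix.diagonal M.diag) ^ j) v w → w ∈ T := by
    intro j
    induction j with
    | zero =>
      intro w hw
      rw [pow_zero, Matrix.one_apply] at hw
      split_ifs at hw with h
      · exact h ▸ hv
      · exact absurd hw (lt_irrefl _)
    | succ j ih =>
      intro w hw
      rw [pow_succ, Matrix.mul_apply] at hw
      obtain ⟨u, -, hu⟩ := Finset.exists_lt_of_sum_lt (s := Finset.univ) (f := fun _ : V => (0 : ℝ))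
        (by simpa using hw)
      have h0 := (pow_entry_le_pow_entry (off_diag_nonneg hM) (fun _ _ => le_rfl) j v u).1
      have h1 := pos_of_mul_pos_right hu h0
      have h2 := pos_of_mul_pos_left hu (off_diag_nonneg hM u w)
      rcases eq_or_ne w u with rfl | h
      · exact ih w h2
      · refine hT u (ih u h2) w h ?_
        simpa [Matrix.diagonal_apply_ne _ h.symm] using h1
  rcases eq_or_ne v w with rfl | h
  · exact hv
  · exact key k w (hk v w h)

end Perron

namespace StochasticNetwork

open Filter Topology

variable {V : Type*} [Fintype V] [DecidableEq V] {S : V → Type*} (N : StochasticNetwork V S)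

/-! ### One step of the chain -/

/-- The states in which some vertex exceeds its threshold. -/
def unstable : Set (State V S) := {x | ¬ N.Stable x.η}

variable (V S) in
/-- The states with nonnegative configuration. -/
def nonnegStates : Set (State V S) := {x | ∀ v, 0 ≤ x.η v}

variable {N}

omit [Fintype V] in
theorem mem_support_topple {x y : State V S} {v : V} :
    y ∈ (N.topple x v).support ↔ ∃ s ∈ (N.P v (x.q v)).support, ∃ ξ ∈ (N.ν v s).support,
      y = ⟨x.η + ξ, Function.update x.q v s⟩ := by
  simp only [topple, PMF.mem_support_bind_iff, PMF.mem_support_map_iff]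
  exact exists_congr fun s => and_congr_right fun _ => exists_congr fun ξ =>
    and_congr_right fun _ => eq_comm

omit [DecidableEq V] in
theorem mem_support_selectVertex {η : V → ℤ} (h : ¬ N.Stable η) {v : V} :
    v ∈ (N.selectVertex η h).support ↔ (N.t v : ℤ) < η v := by
  rw [selectVertex, PMF.mem_support_normalize_iff]
  simp only [weight, ne_eq, Nat.cast_eq_zero]
  omega

theorem step_of_stable {x : State V S} (h : N.Stable x.η) : N.step x = PMF.pure x := by
  simp [step, h]

theorem step_of_unstable {x : State V S} (h : ¬ N.Stable x.η) :
    N.step x = (N.selectVertex x.η h).bind (N.topple x) := by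
  simp [step, h]

theorem mem_support_step {x y : State V S} (h : ¬ N.Stable x.η) :
    y ∈ (N.step x).support ↔ ∃ v, (N.t v : ℤ) < x.η v ∧ y ∈ (N.topple x v).support := by
  rw [step_of_unstable h, PMF.mem_support_bind_iff]
  simp only [mem_support_selectVertex]

theorem mem_support_step_of_lt {x y : State V S} {v : V} (hv : (N.t v : ℤ) < x.η v)
    (hy : y ∈ (N.topple x v).support) : y ∈ (N.step x).support :=
  (mem_support_step fun h => (h v).not_gt hv).2 ⟨v, hv, hy⟩

omit [Fintype V] in
theorem lexp_topple (x : State V S) (v : V) (f : State V S → ℝ≥0∞) :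
    (N.topple x v).lexp f = (N.P v (x.q v)).lexp fun s => (N.ν v s).lexp fun ξ =>
      f ⟨x.η + ξ, Function.update x.q v s⟩ := by
  simp [topple, PMF.lexp_bind, PMF.lexp_map]

theorem lexp_step_le {x : State V S} (h : ¬ N.Stable x.η) {f : State V S → ℝ≥0∞} {c : ℝ≥0∞}
    (hf : ∀ v, (N.t v : ℤ) < x.η v → (N.topple x v).lexp f ≤ c) : (N.step x).lexp f ≤ c := by
  rw [step_of_unstable h, PMF.lexp_bind, ← PMF.lexp_const (N.selectVertex x.η h) c]
  exact PMF.lexp_mono fun v hv => hf v ((mem_support_selectVertex h).1 hv)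

theorem lexp_step_eq {x : State V S} (h : ¬ N.Stable x.η) {f : State V S → ℝ≥0∞} {c : ℝ≥0∞}
    (hf : ∀ v, (N.t v : ℤ) < x.η v → (N.topple x v).lexp f = c) : (N.step x).lexp f = c := by
  rw [step_of_unstable h, PMF.lexp_bind, ← PMF.lexp_const (N.selectVertex x.η h) c]
  exact PMF.lexp_congr fun v hv => hf v ((mem_support_selectVertex h).1 hv)

-- The toppled vertex holds more than `t v` particles and loses at most `t v` by BFB; the others
-- only gain by MOLI.
omit [Fintype V] [DecidableEq V] in
theorem nonneg_add_of_mem_support (hMOLI : N.MOLI) (hBFB : N.BFB) {η : V → ℤ} (hη : ∀ w, 0 ≤ η w)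
    {v : V} (hv : (N.t v : ℤ) < η v) {s : S v} {ξ : V → ℤ} (hξ : ξ ∈ (N.ν v s).support) (w : V) :
    0 ≤ (η + ξ) w := by
  rcases eq_or_ne w v with rfl | hw
  · have := hBFB w s ξ hξ
    simp only [Pi.add_apply]
    omega
  · exact add_nonneg (hη w) (hMOLI v s ξ hξ w hw)

theorem nonnegStates_closed (hMOLI : N.MOLI) (hBFB : N.BFB) :
    ∀ x ∈ nonnegStates V S, ∀ y ∈ (N.step x).support, y ∈ nonnegStates V S := by
  intro x hx y hy
  by_cases h : N.Stable x.η
  · rw [step_of_stable h, PMF.mem_support_pure_iff] at hy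
    exact hy ▸ hx
  · obtain ⟨v, hv, hy⟩ := (mem_support_step h).1 hy
    obtain ⟨s, -, ξ, hξ, rfl⟩ := mem_support_topple.1 hy
    exact nonneg_add_of_mem_support hMOLI hBFB hx hv hξ

/-! ### Stabilization and killed operators -/

section Law

variable [∀ v, Fintype (S v)]

omit [Fintype V] [DecidableEq V] [∀ v, Fintype (S v)] in
theorem measurableSet_forall_lt_unstable (n : ℕ) :
    MeasurableSet {ω : ℕ → State V S | ∀ k < n, ω k ∈ N.unstable} := by
  simp only [Set.ofPred_forall]
  exact MeasurableSet.iInter fun k => MeasurableSet.iInter fun _ =>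
    measurable_pi_apply k (MeasurableSet.of_discrete (s := N.unstable))

theorem law_forall_lt_unstable (η₀ : V → ℕ) (q₀ : ∀ v, S v) (n : ℕ) :
    N.law η₀ q₀ {ω | ∀ k < n, ω k ∈ N.unstable} =
      (killed N.step N.unstable)^[n] (fun _ => 1) ⟨fun v => η₀ v, q₀⟩ := by
  rw [← lintegral_law, ← lintegral_indicator_one (measurableSet_forall_lt_unstable n)]
  rfl

theorem stabilizesAS_of_forall_exists_lt {η₀ : V → ℕ} {q₀ : ∀ v, S v}
    (h : ∀ ε : ℝ≥0∞, ε ≠ 0 →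
      ∃ n, (killed N.step N.unstable)^[n] (fun _ => 1) ⟨fun v => η₀ v, q₀⟩ < ε) :
    N.StabilizesAS η₀ q₀ := by
  rw [StabilizesAS, ae_iff]
  by_contra hne
  obtain ⟨n, hn⟩ := h _ hne
  rw [← law_forall_lt_unstable] at hn
  exact hn.not_ge (measure_mono fun ω hω k _ => fun hk => hω ⟨k, hk⟩)

theorem failsToStabilize_of_forall_le {η₀ : V → ℕ} {q₀ : ∀ v, S v} {ε : ℝ≥0∞} (hε : 0 < ε)
    (h : ∀ n, ε ≤ (killed N.step N.unstable)^[n] (fun _ => 1) ⟨fun v => η₀ v, q₀⟩) :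
    N.FailsToStabilize η₀ q₀ := by
  have hset : {ω : ℕ → State V S | ∀ n, ¬ N.Stable (ω n).η} =
      ⋂ n, {ω : ℕ → State V S | ∀ k < n, ω k ∈ N.unstable} := by
    ext ω
    simp only [Set.mem_iInter]
    exact ⟨fun hω n k _ => hω k, fun hω n => hω (n + 1) n n.lt_succ_self⟩
  rw [FailsToStabilize, hset, Antitone.measure_iInter]
  · refine hε.trans_le (le_iInf fun n => ?_)
    rw [law_forall_lt_unstable]
    exact h n
  · exact fun m n hmn ω hω k hk => hω k (hk.trans_le hmn)
  · exact fun n => (measurableSet_forall_lt_unstable n).nullMeasurableSet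
  · exact ⟨0, measure_ne_top _ _⟩

theorem lintegral_law_apply (η₀ : V → ℕ) (q₀ : ∀ v, S v) (n : ℕ) (f : State V S → ℝ≥0∞) :
    ∫⁻ ω, f (ω n) ∂N.law η₀ q₀ =
      (killed N.step Set.univ)^[n] f ⟨fun v => η₀ v, q₀⟩ := by
  rw [← lintegral_law]
  simp

theorem ae_law_apply_iff (η₀ : V → ℕ) (q₀ : ∀ v, S v) (n : ℕ) (Q : State V S → Prop) :
    (∀ᵐ ω ∂N.law η₀ q₀, Q (ω n)) ↔
      (killed N.step Set.univ)^[n] ({x | ¬ Q x}.indicator fun _ => 1) ⟨fun v => η₀ v, q₀⟩ = 0 := by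
  have hm : Measurable fun ω : ℕ → State V S =>
      {x : State V S | ¬ Q x}.indicator (fun _ => (1 : ℝ≥0∞)) (ω n) :=
    (Measurable.of_discrete (f := {x : State V S | ¬ Q x}.indicator fun _ => (1 : ℝ≥0∞))).comp
      (measurable_pi_apply n)
  rw [← lintegral_law_apply, lintegral_eq_zero_iff hm]
  refine eventually_congr (Eventually.of_forall fun ω => ?_)
  simp [Set.indicator]

end Law

/-! ### Linear functionals of the state -/

/-- The functional `∑ v, (a(v) η(v) + φ(v, q(v)))` of the state. -/
def height (a : V → ℝ) (φ : ∀ v, S v → ℝ) (x : State V S) : ℝ :=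
  ∑ v, (a v * (x.η v : ℝ) + φ v (x.q v))

/-- The change of `height` in a toppling at `v` moving the environment from `s` to `s'` and adding
`ξ`. -/
def increment (a : V → ℝ) (φ : ∀ v, S v → ℝ) (v : V) (s s' : S v) (ξ : V → ℤ) : ℝ :=
  ∑ w, a w * (ξ w : ℝ) + (φ v s' - φ v s)

theorem height_topple (a : V → ℝ) (φ : ∀ v, S v → ℝ) (x : State V S) (v : V) (s : S v)
    (ξ : V → ℤ) : height a φ ⟨x.η + ξ, Function.update x.q v s⟩ =
      height a φ x + increment a φ v (x.q v) s ξ := by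
  have h1 : ∑ w, φ w (Function.update x.q v s w) = ∑ w, φ w (x.q w) + (φ v s - φ v (x.q v)) := by
    rw [← sub_eq_iff_eq_add', ← Finset.sum_sub_distrib, Finset.sum_eq_single v]
    · simp
    · intro w _ hw
      simp [Function.update_of_ne hw]
    · simp
  simp only [height, increment, Finset.sum_add_distrib, h1, Pi.add_apply, Int.cast_add, mul_add]
  ring

section Env

variable [∀ v, Fintype (S v)]

/-- A bound for the contribution of the environment to `height`. -/
def envBound (φ : ∀ v, S v → ℝ) : ℝ := ∑ v, ∑ s, |φ v s|

omit [DecidableEq V] in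
theorem abs_sum_env_le (φ : ∀ v, S v → ℝ) (q : ∀ v, S v) :
    |∑ v, φ v (q v)| ≤ envBound φ :=
  (Finset.abs_sum_le_sum_abs _ _).trans (Finset.sum_le_sum fun v _ =>
    Finset.single_le_sum (f := fun s => |φ v s|) (fun _ _ => abs_nonneg _) (Finset.mem_univ (q v)))

omit [DecidableEq V] [∀ v, Fintype (S v)] in
theorem height_eq (a : V → ℝ) (φ : ∀ v, S v → ℝ) (x : State V S) :
    height a φ x = ∑ v, a v * (x.η v : ℝ) + ∑ v, φ v (x.q v) := by
  rw [height, Finset.sum_add_distrib]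

omit [DecidableEq V] in
theorem height_add_envBound_nonneg {a : V → ℝ} (ha : ∀ v, 0 < a v) (φ : ∀ v, S v → ℝ)
    {x : State V S} (hx : x ∈ nonnegStates V S) : 0 ≤ height a φ x + envBound φ := by
  have h1 := (abs_le.1 (abs_sum_env_le φ x.q)).1
  have h2 : 0 ≤ ∑ v, a v * (x.η v : ℝ) := Finset.sum_nonneg fun v _ =>
    mul_nonneg (ha v).le (by exact_mod_cast hx v)
  rw [height_eq]
  linarith

omit [DecidableEq V] in
theorem height_le_of_stable {a : V → ℝ} (ha : ∀ v, 0 < a v) (φ : ∀ v, S v → ℝ)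
    {x : State V S} (hx : N.Stable x.η) :
    height a φ x ≤ ∑ v, a v * (N.t v : ℝ) + envBound φ := by
  rw [height_eq]
  refine add_le_add (Finset.sum_le_sum fun v _ => mul_le_mul_of_nonneg_left ?_ (ha v).le)
    (abs_le.1 (abs_sum_env_le φ x.q)).2
  exact_mod_cast hx v

-- Positivity of every `a v` confines the configuration to a box; this is what makes the critical
-- case a finite-state problem.
omit [DecidableEq V] in
theorem finite_nonneg_height_lt {a : V → ℝ} (ha : ∀ v, 0 < a v) (φ : ∀ v, S v → ℝ) (L : ℝ) :
    {x : State V S | x ∈ nonnegStates V S ∧ height a φ x < L}.Finite := by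
  let B : V → ℤ := fun v => ⌈(L + envBound φ) / a v⌉
  have hfin : (Set.pi Set.univ (fun v => Set.Icc (0 : ℤ) (B v)) ×ˢ
      (Set.univ : Set (∀ v, S v))).Finite :=
    (Set.Finite.pi fun v => Set.finite_Icc _ _).prod Set.finite_univ
  refine (hfin.image fun p => (⟨p.1, p.2⟩ : State V S)).subset ?_
  rintro ⟨η, q⟩ ⟨hη, hL⟩
  refine ⟨(η, q), ⟨fun v _ => ⟨hη v, ?_⟩, trivial⟩, rfl⟩
  have h1 := (abs_le.1 (abs_sum_env_le φ q)).1
  rw [height_eq] at hL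
  have h2 : a v * (η v : ℝ) ≤ ∑ v, a v * (η v : ℝ) :=
    Finset.single_le_sum (f := fun v => a v * (η v : ℝ))
      (fun v _ => mul_nonneg (ha v).le (by exact_mod_cast hη v)) (Finset.mem_univ v)
  have h3 : (η v : ℝ) ≤ (L + envBound φ) / a v := by
    rw [le_div_iff₀ (ha v)]
    simp only at hL
    linarith
  exact_mod_cast h3.trans (Int.le_ceil _)

omit [DecidableEq V] in
theorem le_height_const {a : V → ℝ} (φ : ∀ v, S v → ℝ) (n : ℕ) (q : ∀ v, S v) :
    n * ∑ v, a v - envBound φ ≤ height a φ ⟨fun _ => ((n : ℕ) : ℤ), q⟩ := by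
  have h1 := (abs_le.1 (abs_sum_env_le φ q)).1
  rw [height_eq]
  simp only [Int.cast_natCast, ← Finset.sum_mul]
  linarith

/-! ### Expectations of increments -/

omit [DecidableEq V] [∀ v, Fintype (S v)] in
theorem integrable_increment (hmean : N.HasMeans) (a : V → ℝ) (φ : ∀ v, S v → ℝ) (v : V)
    (s s' : S v) : Integrable (increment a φ v s s') (N.ν v s').toMeasure :=
  (integrable_finsetSum _ fun w _ => (hmean v s' w).const_mul (a w)).add (integrable_const _)

omit [DecidableEq V] [∀ v, Fintype (S v)] in
theorem integral_increment (hmean : N.HasMeans) (a : V → ℝ) (φ : ∀ v, S v → ℝ) (v : V)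
    (s s' : S v) : ∫ ξ, increment a φ v s s' ξ ∂(N.ν v s').toMeasure =
      ∑ w, a w * N.mean v s' w + (φ v s' - φ v s) := by
  simp only [increment]
  rw [integral_add (integrable_finsetSum _ fun w _ => (hmean v s' w).const_mul (a w))
    (integrable_const _), integral_finsetSum _ fun w _ => (hmean v s' w).const_mul (a w)]
  simp [integral_const_mul, mean]

-- The one-sided bound makes Laplace transforms of increments finite even though the toppling laws
-- are only integrable.
omit [DecidableEq V] in
theorem increment_ge {a : V → ℝ} (ha : ∀ v, 0 < a v) (φ : ∀ v, S v → ℝ) (hMOLI : N.MOLI)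
    (hBFB : N.BFB) (v : V) (s s' : S v) {ξ : V → ℤ} (hξ : ξ ∈ (N.ν v s').support) :
    -(∑ w, a w * (N.t w : ℝ) + ∑ s, |φ v s| + ∑ s, |φ v s|) ≤ increment a φ v s s' ξ := by
  have h1 : ∀ s, |φ v s| ≤ ∑ s, |φ v s| := fun s =>
    Finset.single_le_sum (f := fun s => |φ v s|) (fun s _ => abs_nonneg _) (Finset.mem_univ s)
  have h2 : -∑ w, a w * (N.t w : ℝ) ≤ ∑ w, a w * (ξ w : ℝ) := by
    rw [← Finset.sum_neg_distrib]
    refine Finset.sum_le_sum fun w _ => ?_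
    rw [← mul_neg]
    refine mul_le_mul_of_nonneg_left ?_ (ha w).le
    have : -(N.t w : ℤ) ≤ ξ w := by
      rcases eq_or_ne w v with rfl | hw
      · have := hBFB w s' ξ hξ
        omega
      · have := hMOLI v s' ξ hξ w hw
        omega
    exact_mod_cast this
  have h3 := (abs_le.1 (h1 s')).1
  have h4 := (abs_le.1 (h1 s)).2
  rw [increment]
  linarith

omit [Fintype V] [DecidableEq V] in
theorem sum_toReal_eq_one {α : Type*} [Fintype α] (p : PMF α) : ∑ i, (p i).toReal = 1 := by
  rw [← ENNReal.toReal_sum fun i _ => p.apply_ne_top i, ← tsum_fintype (L := .unconditional _),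
    p.tsum_coe, ENNReal.toReal_one]

omit [Fintype V] [DecidableEq V] in
theorem lexp_ofReal {α : Type*} [Fintype α] (p : PMF α) {f : α → ℝ} (hf : ∀ i, 0 ≤ f i) :
    p.lexp (fun i => ENNReal.ofReal (f i)) = ENNReal.ofReal (∑ i, (p i).toReal * f i) := by
  rw [PMF.lexp, tsum_fintype, ENNReal.ofReal_sum_of_nonneg
    fun i _ => mul_nonneg ENNReal.toReal_nonneg (hf i)]
  refine Finset.sum_congr rfl fun i _ => ?_
  rw [ENNReal.ofReal_mul ENNReal.toReal_nonneg, ENNReal.ofReal_toReal (p.apply_ne_top i)]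

omit [DecidableEq V] [∀ v, Fintype (S v)] in
theorem lexp_ν_ofReal {v : V} {s : S v} {f : (V → ℤ) → ℝ}
    (hf : Integrable f (N.ν v s).toMeasure) (h0 : ∀ ξ ∈ (N.ν v s).support, 0 ≤ f ξ) :
    (N.ν v s).lexp (fun ξ => ENNReal.ofReal (f ξ)) =
      ENNReal.ofReal (∫ ξ, f ξ ∂(N.ν v s).toMeasure) := by
  rw [ofReal_integral_eq_lintegral_ofReal hf ((PMF.ae_toMeasure_iff _ _).2 h0),
    PMF.lintegral_toMeasure]

variable (N) in
/-- `φ` corrects the linear functional `a` so that the expected change of `height a φ` in a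
toppling at `v` is `ρ a(v)`, whatever the environment. -/
def IsCorrector (a : V → ℝ) (φ : ∀ v, S v → ℝ) (ρ : ℝ) : Prop :=
  ∀ v s, ∑ s', (N.P v s s').toReal * (∑ w, a w * N.mean v s' w + (φ v s' - φ v s)) = ρ * a v

variable {π : ∀ v, S v → ℝ}

omit [DecidableEq V] in
theorem mulVec_toppling (a : V → ℝ) (v : V) :
    (N.toppling π).mulVec a v = ∑ s, π v s * ∑ w, a w * N.mean v s w := by
  simp only [Matrix.mulVec, dotProduct, toppling, Finset.sum_mul, Finset.mul_sum]
  rw [Finset.sum_comm]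
  exact Finset.sum_congr rfl fun s _ => Finset.sum_congr rfl fun w _ => by ring

omit [Fintype V] [DecidableEq V] in
theorem sum_stationary_mul (hπ : N.IsStationary π) (v : V) (f : S v → ℝ) :
    ∑ s, π v s * ∑ s', (N.P v s s').toReal * f s' = ∑ s, π v s * f s := by
  have h := Matrix.dotProduct_mulVec (π v) (N.envMatrix v) f
  rw [(hπ v).2] at h
  exact h

-- At each vertex this is the Poisson equation for the expected change of `∑ a η` minus `ρ a(v)`,
-- whose stationary mean vanishes because `a` is an eigenvector.
omit [DecidableEq V] in
theorem exists_isCorrector (hE : ∀ v, (N.envMatrix v).IsIrreducible) (hπ : N.IsStationary π)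
    {a : V → ℝ} {ρ : ℝ} (ha : (N.toppling π).mulVec a = ρ • a) :
    ∃ φ : ∀ v, S v → ℝ, N.IsCorrector a φ ρ := by
  have h : ∀ v, ∃ φ : S v → ℝ, φ - (N.envMatrix v).mulVec φ = fun s =>
      ∑ s', (N.P v s s').toReal * (∑ w, a w * N.mean v s' w) - ρ * a v := by
    intro v
    refine (hE v).exists_poisson (fun s => sum_toReal_eq_one _) (hπ v).2 (hπ v).1.2 ?_
    simp only [mul_sub, Finset.sum_sub_distrib, sum_stationary_mul hπ, ← Finset.sum_mul]
    rw [(hπ v).1.2, ← mulVec_toppling, ha]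
    simp
  choose φ hφ using h
  refine ⟨φ, fun v s => ?_⟩
  have h1 := congrFun (hφ v) s
  simp only [Pi.sub_apply, Matrix.mulVec, dotProduct, envMatrix] at h1
  simp only [mul_add, mul_sub, Finset.sum_add_distrib, Finset.sum_sub_distrib, ← Finset.sum_mul,
    sum_toReal_eq_one] at h1 ⊢
  linarith

/-- The height shifted to be nonnegative on nonnegative configurations. -/
noncomputable def potential (a : V → ℝ) (φ : ∀ v, S v → ℝ) (x : State V S) : ℝ≥0∞ :=
  ENNReal.ofReal (height a φ x + envBound φ)

/-- The truncation in `ENNReal.ofReal` loses nothing, as the shifted height is nonnegative before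
and after the toppling; the drift is then the corrector identity. -/
theorem lexp_topple_potential (hmean : N.HasMeans) (hMOLI : N.MOLI) (hBFB : N.BFB) {a : V → ℝ}
    (ha : ∀ v, 0 < a v) {φ : ∀ v, S v → ℝ} {ρ : ℝ} (hφ : N.IsCorrector a φ ρ) {x : State V S}
    (hx : x ∈ nonnegStates V S) {v : V} (hv : (N.t v : ℤ) < x.η v) :
    0 ≤ height a φ x + envBound φ + ρ * a v ∧ (N.topple x v).lexp (potential a φ) =
      ENNReal.ofReal (height a φ x + envBound φ + ρ * a v) := by
  have hint : ∀ s, Integrable (fun ξ => height a φ x + envBound φ + increment a φ v (x.q v) s ξ)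
      (N.ν v s).toMeasure := fun s =>
    (integrable_const _).add (integrable_increment hmean a φ v (x.q v) s)
  have hnn : ∀ s, ∀ ξ ∈ (N.ν v s).support,
      0 ≤ height a φ x + envBound φ + increment a φ v (x.q v) s ξ := by
    intro s ξ hξ
    have := height_add_envBound_nonneg ha φ
      (x := ⟨x.η + ξ, Function.update x.q v s⟩) (nonneg_add_of_mem_support hMOLI hBFB hx hv hξ)
    rw [height_topple] at this
    linarith
  have hinn : ∀ s, 0 ≤ ∫ ξ, (height a φ x + envBound φ + increment a φ v (x.q v) s ξ)
      ∂(N.ν v s).toMeasure := fun s =>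
    integral_nonneg_of_ae ((PMF.ae_toMeasure_iff _ _).2 (hnn s))
  have hsum : ∑ s, (N.P v (x.q v) s).toReal *
      ∫ ξ, (height a φ x + envBound φ + increment a φ v (x.q v) s ξ) ∂(N.ν v s).toMeasure =
      height a φ x + envBound φ + ρ * a v := by
    rw [← hφ v (x.q v)]
    have : ∀ s, ∫ ξ, (height a φ x + envBound φ + increment a φ v (x.q v) s ξ)
        ∂(N.ν v s).toMeasure = height a φ x + envBound φ +
          (∑ w, a w * N.mean v s w + (φ v s - φ v (x.q v))) := by
      intro s
      rw [integral_add (integrable_const _) (integrable_increment hmean a φ v (x.q v) s),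
        integral_increment hmean]
      simp
    simp only [this, mul_add _ (height a φ x + envBound φ), Finset.sum_add_distrib,
      ← Finset.sum_mul, sum_toReal_eq_one, one_mul]
  refine ⟨hsum ▸ Finset.sum_nonneg fun s _ => mul_nonneg ENNReal.toReal_nonneg (hinn s), ?_⟩
  rw [lexp_topple, ← hsum, ← lexp_ofReal _ hinn]
  refine PMF.lexp_congr fun s _ => ?_
  rw [← lexp_ν_ofReal (hint s) (hnn s)]
  refine PMF.lexp_congr fun ξ _ => ?_
  rw [potential, height_topple]
  congr 1
  ring

/-! ### The subcritical phase -/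

theorem stabilizesAS_of_neg (hmean : N.HasMeans) (hMOLI : N.MOLI) (hBFB : N.BFB) [Nonempty V]
    {a : V → ℝ} (ha : ∀ v, 0 < a v) {φ : ∀ v, S v → ℝ} {ρ : ℝ} (hφ : N.IsCorrector a φ ρ)
    (hρ : ρ < 0) (η₀ : V → ℕ) (q₀ : ∀ v, S v) : N.StabilizesAS η₀ q₀ := by
  obtain ⟨m, -, hm⟩ := Finset.exists_min_image Finset.univ a Finset.univ_nonempty
  -- The smallest expected decrease over all vertices, hence a drift uniform in the unstable state.
  set c := -ρ * a m
  have hc : 0 < c := mul_pos (neg_pos.2 hρ) (ha m)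
  have hdrift : ∀ x ∈ nonnegStates V S, x ∈ N.unstable →
      (N.step x).lexp (potential a φ) + ENNReal.ofReal c ≤ potential a φ x := by
    intro x hx hU
    have hlt : ∀ v, ρ * a v ≤ -c := fun v => by
      have := mul_le_mul_of_nonneg_left (hm v (Finset.mem_univ v)) (neg_pos.2 hρ).le
      simp only [c]
      linarith
    have h1 : (N.step x).lexp (fun y => potential a φ y + ENNReal.ofReal c) ≤ potential a φ x := by
      refine lexp_step_le hU fun v hv => ?_
      obtain ⟨h0, h⟩ := lexp_topple_potential hmean hMOLI hBFB ha hφ hx hv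
      rw [PMF.lexp_add, PMF.lexp_const, h, ← ENNReal.ofReal_add h0 hc.le]
      refine ENNReal.ofReal_le_ofReal ?_
      linarith [hlt v]
    rwa [PMF.lexp_add, PMF.lexp_const] at h1
  refine stabilizesAS_of_forall_exists_lt fun ε hε => ?_
  set x₀ : State V S := ⟨fun v => η₀ v, q₀⟩
  have hx₀ : x₀ ∈ nonnegStates V S := fun v => Int.natCast_nonneg _
  by_contra! hcon
  have hbound : ∀ n : ℕ, n * (ENNReal.ofReal c * ε) ≤ potential a φ x₀ := fun n => by
    rw [← mul_assoc]
    exact (mul_le_mul_right (hcon n) _).trans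
      (killed_foster (nonnegStates_closed hMOLI hBFB) hdrift n x₀ hx₀)
  obtain ⟨n, hn⟩ := ENNReal.exists_nat_mul_gt
    (a := ENNReal.ofReal c * ε) (b := potential a φ x₀)
    (mul_ne_zero (ENNReal.ofReal_pos.2 hc).ne' hε) ENNReal.ofReal_ne_top
  exact hn.not_ge (hbound n)

/-! ### The supercritical phase -/

-- With `y = θ * Y` and `0 < θ ≤ 1`, this dominates the difference quotients of the Laplace
-- transform by a multiple of `|Y|`.
omit [Fintype V] [DecidableEq V] [∀ v, Fintype (S v)] in
theorem abs_one_sub_exp_neg_le {y C : ℝ} (hy : -C ≤ y) (hC : 0 ≤ C) :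
    |1 - Real.exp (-y)| ≤ |y| * Real.exp C := by
  have h1 : 1 ≤ Real.exp C := Real.one_le_exp hC
  have h2 := Real.add_one_le_exp (-y)
  have h3 : Real.exp (-y) - 1 ≤ -y * Real.exp (-y) := by
    have h4 := mul_le_mul_of_nonneg_right (Real.add_one_le_exp y) (Real.exp_pos (-y)).le
    rw [← Real.exp_add, add_neg_cancel, Real.exp_zero] at h4
    linarith
  have h5 : Real.exp (-y) ≤ Real.exp C := Real.exp_le_exp.2 (by linarith)
  have h6 : -y * Real.exp (-y) ≤ |y| * Real.exp C :=
    mul_le_mul (neg_le_abs y) h5 (Real.exp_pos _).le (abs_nonneg y)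
  rw [abs_le]
  constructor
  · linarith
  · have : |y| ≤ |y| * Real.exp C := le_mul_of_one_le_right (abs_nonneg y) h1
    linarith [le_abs_self y]

omit [Fintype V] [DecidableEq V] [∀ v, Fintype (S v)] in
/-- The right derivative at `0` of the Laplace transform of an integrable variable bounded
below. -/
theorem tendsto_laplace {Ω : Type*} [MeasurableSpace Ω] {μ : Measure Ω} [IsProbabilityMeasure μ]
    {Y : Ω → ℝ} (hY : Integrable Y μ) {C : ℝ} (hC : 0 ≤ C) (hYC : ∀ᵐ ω ∂μ, -C ≤ Y ω) :
    (∀ θ, 0 < θ → Integrable (fun ω => Real.exp (-(θ * Y ω))) μ) ∧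
    Tendsto (fun θ : ℝ => θ⁻¹ * (1 - ∫ ω, Real.exp (-(θ * Y ω)) ∂μ)) (𝓝[>] 0)
      (𝓝 (∫ ω, Y ω ∂μ)) := by
  have hmeas : ∀ θ : ℝ, AEStronglyMeasurable (fun ω => Real.exp (-(θ * Y ω))) μ := fun θ =>
    Real.continuous_exp.comp_aestronglyMeasurable (hY.1.const_mul θ).neg
  have hint : ∀ θ, 0 < θ → Integrable (fun ω => Real.exp (-(θ * Y ω))) μ := fun θ hθ => by
    refine Integrable.of_bound (hmeas θ) (Real.exp (θ * C)) ?_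
    filter_upwards [hYC] with ω hω
    rw [Real.norm_of_nonneg (Real.exp_pos _).le, Real.exp_le_exp]
    nlinarith
  refine ⟨hint, ?_⟩
  have hlim : Tendsto (fun θ : ℝ => ∫ ω, θ⁻¹ * (1 - Real.exp (-(θ * Y ω))) ∂μ) (𝓝[>] 0)
      (𝓝 (∫ ω, Y ω ∂μ)) := by
    refine tendsto_integral_filter_of_dominated_convergence (fun ω => |Y ω| * Real.exp C)
      (Eventually.of_forall fun θ => ((aestronglyMeasurable_const).sub (hmeas θ)).const_mul _)
      ?_ (hY.abs.mul_const _) (Eventually.of_forall fun ω => ?_)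
    · filter_upwards [Ioc_mem_nhdsGT (zero_lt_one (α := ℝ))] with θ hθ
      filter_upwards [hYC] with ω hω
      have h1 : -C ≤ θ * Y ω := by nlinarith [hθ.1, hθ.2]
      rw [norm_mul, Real.norm_eq_abs, Real.norm_eq_abs, abs_of_pos (inv_pos.2 hθ.1),
        inv_mul_le_iff₀ hθ.1]
      refine (abs_one_sub_exp_neg_le h1 hC).trans_eq ?_
      rw [abs_mul, abs_of_pos hθ.1, mul_assoc]
    · have hd : HasDerivAt (fun θ : ℝ => 1 - Real.exp (-(θ * Y ω))) (Y ω) 0 := by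
        have h1 := (((hasDerivAt_id (0 : ℝ)).mul_const (Y ω)).neg.exp).const_sub 1
        simpa using h1
      simpa using hd.tendsto_slope_zero_right
  refine hlim.congr' ?_
  filter_upwards [self_mem_nhdsWithin] with θ hθ
  rw [integral_const_mul, integral_sub (integrable_const _) (hint θ hθ)]
  simp

-- Averaged over the next environment, one minus the Laplace transform has right derivative `ρ a(v)
-- > 0` at `0`. As there are finitely many pairs `(v, s)`, one small `θ` suits all.
omit [DecidableEq V] in
theorem exists_laplace_le_one (hmean : N.HasMeans) (hMOLI : N.MOLI) (hBFB : N.BFB) {a : V → ℝ}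
    (ha : ∀ v, 0 < a v) {φ : ∀ v, S v → ℝ} {ρ : ℝ} (hφ : N.IsCorrector a φ ρ) (hρ : 0 < ρ) :
    ∃ θ > 0, (∀ v s s', Integrable (fun ξ => Real.exp (-(θ * increment a φ v s s' ξ)))
      (N.ν v s').toMeasure) ∧ ∀ v s, ∑ s', (N.P v s s').toReal *
        ∫ ξ, Real.exp (-(θ * increment a φ v s s' ξ)) ∂(N.ν v s').toMeasure ≤ 1 := by
  have hL : ∀ v s s', (∀ θ, 0 < θ →
      Integrable (fun ξ => Real.exp (-(θ * increment a φ v s s' ξ))) (N.ν v s').toMeasure) ∧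
      Tendsto (fun θ : ℝ => θ⁻¹ * (1 - ∫ ξ, Real.exp (-(θ * increment a φ v s s' ξ))
        ∂(N.ν v s').toMeasure)) (𝓝[>] 0)
        (𝓝 (∫ ξ, increment a φ v s s' ξ ∂(N.ν v s').toMeasure)) := fun v s s' => by
    refine tendsto_laplace (integrable_increment hmean a φ v s s') ?_
      ((PMF.ae_toMeasure_iff _ _).2 fun ξ hξ => increment_ge ha φ hMOLI hBFB v s s' hξ)
    have h1 : 0 ≤ ∑ w, a w * (N.t w : ℝ) :=
      Finset.sum_nonneg fun w _ => mul_nonneg (ha w).le (Nat.cast_nonneg _)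
    have h2 : 0 ≤ ∑ s, |φ v s| := Finset.sum_nonneg fun s _ => abs_nonneg _
    linarith
  have hev : ∀ v s, ∀ᶠ θ in 𝓝[>] (0 : ℝ), ∑ s', (N.P v s s').toReal *
      ∫ ξ, Real.exp (-(θ * increment a φ v s s' ξ)) ∂(N.ν v s').toMeasure ≤ 1 := by
    intro v s
    have hlim := tendsto_finsetSum Finset.univ fun s' _ =>
      ((hL v s s').2.const_mul (N.P v s s').toReal)
    simp only [integral_increment hmean] at hlim
    rw [hφ v s] at hlim
    filter_upwards [hlim.eventually (lt_mem_nhds (mul_pos hρ (ha v))), self_mem_nhdsWithin]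
      with θ h1 hθ
    have h2 : ∀ s', (N.P v s s').toReal * (θ⁻¹ * (1 - ∫ ξ, Real.exp (-(θ * increment a φ v s s' ξ))
        ∂(N.ν v s').toMeasure)) = θ⁻¹ * ((N.P v s s').toReal - (N.P v s s').toReal *
        ∫ ξ, Real.exp (-(θ * increment a φ v s s' ξ)) ∂(N.ν v s').toMeasure) := fun s' => by ring
    simp only [h2, ← Finset.mul_sum, Finset.sum_sub_distrib, sum_toReal_eq_one] at h1
    have h3 := pos_of_mul_pos_right h1 (inv_pos.2 hθ).le
    linarith
  obtain ⟨θ, h1, hθ⟩ := ((eventually_all.2 fun v => eventually_all.2 (hev v)).and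
    (self_mem_nhdsWithin : Set.Ioi (0 : ℝ) ∈ 𝓝[>] 0)).exists
  exact ⟨θ, hθ, fun v s s' => (hL v s s').1 θ hθ, h1⟩

theorem exists_failsToStabilize_of_pos (hmean : N.HasMeans) (hMOLI : N.MOLI) (hBFB : N.BFB)
    [Nonempty V] {a : V → ℝ} (ha : ∀ v, 0 < a v) {φ : ∀ v, S v → ℝ} {ρ : ℝ}
    (hφ : N.IsCorrector a φ ρ) (hρ : 0 < ρ) (q₀ : ∀ v, S v) :
    ∃ η₀ : V → ℕ, N.FailsToStabilize η₀ q₀ := by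
  obtain ⟨θ, hθ, hint, hle⟩ := exists_laplace_le_one hmean hMOLI hBFB ha hφ hρ
  -- An upper bound for the height of stable states, so that the supermartingale `f` is at least `1`
  -- there.
  set K := ∑ v, a v * (N.t v : ℝ) + envBound φ
  let f : State V S → ℝ≥0∞ := fun x => ENNReal.ofReal (Real.exp (θ * (K - height a φ x)))
  have hdrift : ∀ x ∈ (Set.univ : Set (State V S)), x ∈ N.unstable →
      (N.step x).lexp f ≤ f x := by
    intro x _ hU
    refine lexp_step_le hU fun v _ => ?_
    have h1 : ∀ s ξ, f ⟨x.η + ξ, Function.update x.q v s⟩ =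
        f x * ENNReal.ofReal (Real.exp (-(θ * increment a φ v (x.q v) s ξ))) := by
      intro s ξ
      simp only [f]
      rw [← ENNReal.ofReal_mul (Real.exp_pos _).le, ← Real.exp_add, height_topple]
      congr 2
      ring
    rw [lexp_topple]
    simp only [h1, PMF.lexp_const_mul, lexp_ν_ofReal (hint v _ _) fun ξ _ => (Real.exp_pos _).le]
    rw [lexp_ofReal _ fun s => integral_nonneg fun ξ => (Real.exp_pos _).le]
    refine mul_le_of_le_one_right zero_le ?_
    rw [← ENNReal.ofReal_one]
    exact ENNReal.ofReal_le_ofReal (hle v (x.q v))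
  have hstable : ∀ x ∈ (Set.univ : Set (State V S)), x ∉ N.unstable → 1 ≤ f x := by
    intro x _ hx
    have h1 := height_le_of_stable ha φ (N := N) (x := x) (not_not.1 hx)
    rw [← ENNReal.ofReal_one]
    exact ENNReal.ofReal_le_ofReal (Real.one_le_exp (mul_nonneg hθ.le (sub_nonneg.2 h1)))
  have hasum : 0 < ∑ v, a v := Finset.sum_pos (fun v _ => ha v) Finset.univ_nonempty
  -- With `n` particles everywhere the height exceeds `K`, so `f < 1` and survival has probability
  -- at least `1 - f`.
  obtain ⟨n, hn⟩ := exists_nat_gt ((K + envBound φ) / ∑ v, a v)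
  rw [div_lt_iff₀ hasum] at hn
  have hlt : f ⟨fun _ => ((n : ℕ) : ℤ), q₀⟩ < 1 := by
    have h1 := le_height_const (a := a) φ n q₀
    rw [← ENNReal.ofReal_one]
    refine (ENNReal.ofReal_lt_ofReal_iff zero_lt_one).2 (Real.exp_lt_one_iff.2 ?_)
    exact mul_neg_of_pos_of_neg hθ (by linarith)
  refine ⟨fun _ => n, failsToStabilize_of_forall_le (tsub_pos_of_lt hlt) fun m => ?_⟩
  rw [tsub_le_iff_right]
  exact one_le_killed_add (fun _ _ _ _ => trivial) hdrift hstable m _ trivial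

end Env

end StochasticNetwork

namespace StochasticNetwork

open Filter Topology

variable {V : Type*} [Fintype V] [DecidableEq V] {S : V → Type*} {N : StochasticNetwork V S}

/-! ### Recurrent classes of unstable states -/

section Recurrent

variable {y : State V S}

/-- In a recurrent class, a vertex toppled in some state is toppled in a state with any given
attained environment. -/
theorem exists_topplable_of_reach (hun : ∀ z, Reach N.step y z → ¬ N.Stable z.η)
    {v : V} {z z₀ : State V S} (hz : Reach N.step y z) (hzz₀ : Reach N.step z z₀)
    (hv : (N.t v : ℤ) < z₀.η v) :
    ∃ z', Reach N.step y z' ∧ z'.q v = z.q v ∧ (N.t v : ℤ) < z'.η v := by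
  -- Follow the path until `v` first topples; the environment at `v` is unchanged until then. If
  -- this never happens, the endpoint `z₀` serves.
  induction hzz₀ using Relation.ReflTransGen.head_induction_on with
  | refl => exact ⟨z₀, hz, rfl, hv⟩
  | @head z z₁ hzz₁ _ ih =>
    obtain ⟨u, hu, hz₁⟩ := (mem_support_step (hun z hz)).1 hzz₁
    rcases eq_or_ne v u with rfl | hvu
    · exact ⟨z, hz, rfl, hu⟩
    · obtain ⟨z', hz', hq, hη⟩ := ih (hz.tail hzz₁)
      obtain ⟨s, -, ξ, -, rfl⟩ := mem_support_topple.1 hz₁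
      refine ⟨z', hz', ?_, hη⟩
      rw [hq]
      exact Function.update_of_ne hvu _ _

/-- In a recurrent class, a vertex that is toppled is toppled in every environment. -/
theorem exists_topplable_with_env (hE : ∀ v, (N.envMatrix v).IsIrreducible)
    (hun : ∀ z, Reach N.step y z → ¬ N.Stable z.η)
    (hrec : ∀ z, Reach N.step y z → Reach N.step z y) {v : V} {z₀ : State V S}
    (hz₀ : Reach N.step y z₀) (hv : (N.t v : ℤ) < z₀.η v) (s : S v) :
    ∃ z, Reach N.step y z ∧ z.q v = s ∧ (N.t v : ℤ) < z.η v := by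
  -- By recurrence `z₀` is reachable from anywhere in the class, so an environment just attained at
  -- `v` is still there at a moment when `v` can topple. The set of such environments is thus closed
  -- under `P v`.
  have key : ∀ z, Reach N.step y z →
      ∃ z', Reach N.step y z' ∧ z'.q v = z.q v ∧ (N.t v : ℤ) < z'.η v := fun z hz =>
    exists_topplable_of_reach hun hz ((hrec z hz).trans hz₀) hv
  refine (hE v).mem_of_closed
    (T := {s | ∃ z, Reach N.step y z ∧ z.q v = s ∧ (N.t v : ℤ) < z.η v})
    ⟨z₀, hz₀, rfl, hv⟩ ?_ s
  rintro _ ⟨z, hz, rfl, hzv⟩ s' hs'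
  obtain ⟨ξ, hξ⟩ := (N.ν v s').support_nonempty
  have hP : s' ∈ (N.P v (z.q v)).support := fun h => by simp [envMatrix, h] at hs'
  have hstep := mem_support_step_of_lt hzv (mem_support_topple.2 ⟨s', hP, ξ, hξ, rfl⟩)
  obtain ⟨z', hz', hq, hη⟩ := key _ (hz.tail hstep)
  exact ⟨z', hz', by simpa using hq, hη⟩

/-- Only topplings at `w` decrease the number of particles at `w`. -/
theorem le_of_reach_of_not_toppled (hMOLI : N.MOLI)
    (hun : ∀ z, Reach N.step y z → ¬ N.Stable z.η) {w : V}
    (hw : ∀ z, Reach N.step y z → ¬ (N.t w : ℤ) < z.η w) {z z' : State V S}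
    (hz : Reach N.step y z) (hzz' : Reach N.step z z') : z.η w ≤ z'.η w := by
  induction hzz' with
  | refl => exact le_rfl
  | @tail x x' hx hxx' ih =>
    have hyx : Reach N.step y x := Relation.ReflTransGen.trans hz hx
    obtain ⟨u, hu, hx'⟩ := (mem_support_step (hun x hyx)).1 hxx'
    obtain ⟨s, -, ξ, hξ, rfl⟩ := mem_support_topple.1 hx'
    have hwu : w ≠ u := by
      rintro rfl
      exact hw x hyx hu
    exact ih.trans (le_add_of_nonneg_right (hMOLI u s ξ hξ w hwu))

variable [∀ v, Fintype (S v)] {π : ∀ v, S v → ℝ}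

omit [DecidableEq V] in
theorem toppling_off_diag_nonneg (hπ : N.IsStationary π) (hMOLI : N.MOLI) :
    ∀ v w, w ≠ v → 0 ≤ N.toppling π v w := by
  intro v w hw
  refine Finset.sum_nonneg fun s _ => mul_nonneg ((hπ v).1.1 s) ?_
  refine integral_nonneg_of_ae ((PMF.ae_toMeasure_iff _ _).2 fun ξ hξ => ?_)
  exact Int.cast_nonneg (hMOLI v s ξ hξ w hw)

omit [DecidableEq V] in
/-- If `v` sends particles to `w` on average, then some toppling at `v` of positive probability
does so. -/
theorem exists_toppling_to (hπ : N.IsStationary π) {v w : V} (hvw : 0 < N.toppling π v w) :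
    ∃ s, ∃ s' ∈ (N.P v s).support, ∃ ξ ∈ (N.ν v s').support, 0 < ξ w := by
  obtain ⟨s', -, hs'⟩ := Finset.exists_lt_of_sum_lt
    (show ∑ _ : S v, (0 : ℝ) < ∑ s, π v s * N.mean v s w by rw [Finset.sum_const_zero]; exact hvw)
  have hπs : 0 < π v s' := lt_of_le_of_ne ((hπ v).1.1 s') fun h => by simp [← h] at hs'
  have hmean : 0 < N.mean v s' w := pos_of_mul_pos_right hs' hπs.le
  -- Stationarity and `π v s' > 0` provide a predecessor `s` from which the environment moves to
  -- `s'`.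
  have h1 := congrFun (hπ v).2 s'
  rw [← h1] at hπs
  obtain ⟨s, -, hs⟩ := Finset.exists_lt_of_sum_lt (s := Finset.univ)
    (f := fun _ : S v => (0 : ℝ)) (by simpa [Matrix.vecMul, dotProduct] using hπs)
  refine ⟨s, s', fun h => by simp [envMatrix, h] at hs, ?_⟩
  by_contra! hcon
  refine hmean.not_ge (integral_nonpos_of_ae ((PMF.ae_toMeasure_iff _ _).2 fun ξ hξ => ?_))
  exact Int.cast_nonpos.2 (hcon ξ hξ)

/-- In a recurrent class of unstable states every vertex is toppled. -/
theorem exists_topplable_of_recurrent (hE : ∀ v, (N.envMatrix v).IsIrreducible)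
    (hπ : N.IsStationary π) (hMOLI : N.MOLI) (hIRR : ToppleIrreducible (N.toppling π))
    (hun : ∀ z, Reach N.step y z → ¬ N.Stable z.η)
    (hrec : ∀ z, Reach N.step y z → Reach N.step z y) (v : V) :
    ∃ z, Reach N.step y z ∧ (N.t v : ℤ) < z.η v := by
  obtain ⟨v₀, hv₀⟩ : ∃ v, (N.t v : ℤ) < y.η v := by
    have := hun y Relation.ReflTransGen.refl
    simpa [Stable] using this
  refine hIRR.mem_of_closed (toppling_off_diag_nonneg hπ hMOLI)
    (T := {v | ∃ z, Reach N.step y z ∧ (N.t v : ℤ) < z.η v})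
    ⟨y, Relation.ReflTransGen.refl, hv₀⟩ ?_ v
  rintro v ⟨z₀, hz₀, hv⟩ w hwv hM
  obtain ⟨s, s', hs', ξ, hξ, hξw⟩ := exists_toppling_to hπ hM
  obtain ⟨z, hz, rfl, hzv⟩ := exists_topplable_with_env hE hun hrec hz₀ hv s
  have hstep := mem_support_step_of_lt hzv (mem_support_topple.2 ⟨s', hs', ξ, hξ, rfl⟩)
  -- If `w` never topples, its particle count never decreases along the class; yet this toppling
  -- raises it strictly and recurrence leads back to `z`.
  by_contra hcon
  have hcon' : ∀ z, Reach N.step y z → ¬ (N.t w : ℤ) < z.η w := fun z hz h => hcon ⟨z, hz, h⟩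
  have h1 := le_of_reach_of_not_toppled hMOLI hun hcon' (hz.tail hstep)
    ((hrec _ (hz.tail hstep)).trans hz)
  simp only [Pi.add_apply] at h1
  omega

/-- A functional constant on a recurrent class of unstable states is not changed by any
toppling. -/
theorem increment_eq_zero_of_recurrent (hE : ∀ v, (N.envMatrix v).IsIrreducible)
    (hπ : N.IsStationary π) (hMOLI : N.MOLI) (hIRR : ToppleIrreducible (N.toppling π))
    (hun : ∀ z, Reach N.step y z → ¬ N.Stable z.η)
    (hrec : ∀ z, Reach N.step y z → Reach N.step z y) {a : V → ℝ} {φ : ∀ v, S v → ℝ}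
    (hconst : ∀ z, Reach N.step y z → height a φ z = height a φ y) (v : V) (s : S v) :
    ∀ s' ∈ (N.P v s).support, ∀ ξ ∈ (N.ν v s').support, increment a φ v s s' ξ = 0 := by
  intro s' hs' ξ hξ
  obtain ⟨z₀, hz₀, hv⟩ := exists_topplable_of_recurrent hE hπ hMOLI hIRR hun hrec v
  obtain ⟨z, hz, rfl, hzv⟩ := exists_topplable_with_env hE hun hrec hz₀ hv s
  have hstep := mem_support_step_of_lt hzv (mem_support_topple.2 ⟨s', hs', ξ, hξ, rfl⟩)
  have h1 := hconst _ (hz.tail hstep)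
  rw [height_topple, hconst z hz] at h1
  linarith

end Recurrent

/-! ### Conserved quantities -/

variable [∀ v, Fintype (S v)] {π : ∀ v, S v → ℝ}

/-- Every toppling, in every environment, is a possible first step from some initial state, so
almost sure conservation is a condition on single transitions. -/
theorem isConserved_iff (q : ∀ v, S v) {a : V → ℝ} {φ : ∀ v, S v → ℝ} :
    N.IsConserved a φ ↔ a ≠ 0 ∧ ∀ v s, ∀ s' ∈ (N.P v s).support, ∀ ξ ∈ (N.ν v s').support,
      increment a φ v s s' ξ = 0 := by
  have hae : ∀ (η₀ : V → ℕ) (q₀ : ∀ v, S v), (∀ᵐ ω ∂N.law η₀ q₀, ∀ n,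
      ∑ v, (a v * ((ω n).η v : ℝ) + φ v ((ω n).q v)) = ∑ v, (a v * (η₀ v : ℝ) + φ v (q₀ v))) ↔
      ∀ n, (killed N.step Set.univ)^[n] ({x : State V S |
        ¬ height a φ x = height a φ ⟨fun v => η₀ v, q₀⟩}.indicator fun _ => 1)
          ⟨fun v => η₀ v, q₀⟩ = 0 := by
    intro η₀ q₀
    rw [ae_all_iff]
    refine forall_congr' fun n => ?_
    rw [← ae_law_apply_iff η₀ q₀ n fun x => height a φ x = height a φ ⟨fun v => η₀ v, q₀⟩]
    simp [height]
  refine and_congr_right fun _ => ⟨fun h v s s' hs' ξ hξ => ?_, fun h η₀ q₀ => ?_⟩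
  -- One particle above the threshold lets `v` topple first, with environment `s`; `q` only fills in
  -- the other vertices.
  · have h1 := (hae (fun _ => N.t v + 1) (Function.update q v s)).1 (h _ _) 1
    rw [Function.iterate_one, killed_of_mem (Set.mem_univ _), PMF.lexp_eq_zero_iff] at h1
    have h2 := h1 _ (mem_support_step_of_lt (v := v) (by simp)
      (mem_support_topple.2 ⟨s', by simpa using hs', ξ, hξ, rfl⟩))
    by_contra hne
    rw [Set.indicator_of_mem] at h2
    · exact one_ne_zero h2
    · intro h3
      rw [height_topple] at h3
      simp only [Function.update_self] at h3
      exact hne (by linarith)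
  · refine (hae η₀ q₀).2 fun n => ?_
    set g : State V S → ℝ≥0∞ := {x : State V S |
      ¬ height a φ x = height a φ ⟨fun v => η₀ v, q₀⟩}.indicator fun _ => 1
    -- The indicator `g` of a changed height is superharmonic, so its iterates stay below `g`, which
    -- is zero at the start.
    have hg : killed N.step Set.univ g ≤ g := by
      intro x
      rw [killed_of_mem (Set.mem_univ x)]
      by_cases hx : height a φ x = height a φ ⟨fun v => η₀ v, q₀⟩
      · refine le_of_eq_of_le ?_ zero_le
        refine PMF.lexp_eq_zero_iff.2 fun y hy => Set.indicator_of_notMem ?_ _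
        refine not_not.2 ?_
        by_cases hst : N.Stable x.η
        · rw [step_of_stable hst, PMF.mem_support_pure_iff] at hy
          exact hy ▸ hx
        · obtain ⟨v, -, hy⟩ := (mem_support_step hst).1 hy
          obtain ⟨s, hs, ξ, hξ, rfl⟩ := mem_support_topple.1 hy
          rw [height_topple, h v _ s hs ξ hξ, add_zero, hx]
      · have : g x = 1 := Set.indicator_of_mem (s := {x : State V S |
          ¬ height a φ x = height a φ ⟨fun v => η₀ v, q₀⟩}) hx _
        rw [this]
        refine (PMF.lexp_mono fun y _ => Set.indicator_le_self' (fun _ _ => zero_le) y).trans ?_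
        simp
    have hle : (killed N.step Set.univ)^[n] g ≤ g := by
      induction n with
      | zero => exact le_rfl
      | succ n ih =>
        rw [Function.iterate_succ_apply']
        exact (killed_mono ih).trans hg
    refine le_antisymm ((hle _).trans_eq ?_) zero_le
    simp [g]

-- Averaging the vanishing increments over the toppling and then over a stationary environment
-- cancels the `φ` terms.
omit [DecidableEq V] in
theorem mulVec_toppling_eq_zero (hmean : N.HasMeans) (hπ : N.IsStationary π) {a : V → ℝ}
    {φ : ∀ v, S v → ℝ} (h : ∀ v s, ∀ s' ∈ (N.P v s).support, ∀ ξ ∈ (N.ν v s').support,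
      increment a φ v s s' ξ = 0) : (N.toppling π).mulVec a = 0 := by
  funext v
  have h1 : ∀ s s', (N.P v s s').toReal * (∑ w, a w * N.mean v s' w + φ v s') =
      (N.P v s s').toReal * φ v s := by
    intro s s'
    by_cases hs' : N.P v s s' = 0
    · simp [hs']
    · have h2 : ∫ ξ, increment a φ v s s' ξ ∂(N.ν v s').toMeasure = 0 :=
        integral_eq_zero_of_ae ((PMF.ae_toMeasure_iff _ _).2 (h v s s' hs'))
      rw [integral_increment hmean] at h2
      congr 1
      linarith
  have h2 := sum_stationary_mul hπ v fun s' => ∑ w, a w * N.mean v s' w + φ v s'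
  simp only [h1, ← Finset.sum_mul, sum_toReal_eq_one, one_mul, mul_add,
    Finset.sum_add_distrib] at h2
  rw [mulVec_toppling]
  simpa using h2

/-- A conserved quantity whose coefficients are proportional to a positive vector prevents
stabilization. -/
theorem exists_not_stabilizesAS_of_isConserved [Nonempty V] {a : V → ℝ} (ha : ∀ v, 0 < a v)
    {c : ℝ} {φ : ∀ v, S v → ℝ} (h : N.IsConserved (c • a) φ) (q₀ : ∀ v, S v) :
    ∃ η₀ : V → ℕ, ¬ N.StabilizesAS η₀ q₀ := by
  have hc : c ≠ 0 := by
    rintro rfl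
    exact h.1 (zero_smul ℝ a)
  have hasum : 0 < ∑ v, a v := Finset.sum_pos (fun v _ => ha v) Finset.univ_nonempty
  -- The initial value of `∑ a η` exceeds its maximum over stable configurations by more than any
  -- change of the environment term, divided by `|c|`, can offset.
  obtain ⟨n, hn⟩ := exists_nat_gt
    ((∑ v, a v * (N.t v : ℝ) + (envBound φ + envBound φ) / |c|) / ∑ v, a v)
  rw [div_lt_iff₀ hasum] at hn
  refine ⟨fun _ => n, fun hst => ?_⟩
  obtain ⟨ω, ⟨m, hm⟩, hω⟩ := (hst.and (h.2 (fun _ => n) q₀)).exists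
  have h1 := hω m
  simp only [Pi.smul_apply, smul_eq_mul, Finset.sum_add_distrib, mul_assoc, ← Finset.mul_sum,
    ← Finset.sum_mul] at h1
  have h2 : ∑ v, a v * ((ω m).η v : ℝ) ≤ ∑ v, a v * (N.t v : ℝ) :=
    Finset.sum_le_sum fun v _ => mul_le_mul_of_nonneg_left (by exact_mod_cast hm v) (ha v).le
  have h3 : c * ((∑ v, a v) * n - ∑ v, a v * ((ω m).η v : ℝ)) =
      ∑ v, φ v ((ω m).q v) - ∑ v, φ v (q₀ v) := by linarith
  have h4 : |c| * ((∑ v, a v) * n - ∑ v, a v * ((ω m).η v : ℝ)) ≤ envBound φ + envBound φ := by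
    calc |c| * ((∑ v, a v) * n - ∑ v, a v * ((ω m).η v : ℝ))
        ≤ |c| * |(∑ v, a v) * n - ∑ v, a v * ((ω m).η v : ℝ)| :=
          mul_le_mul_of_nonneg_left (le_abs_self _) (abs_nonneg c)
      _ = |∑ v, φ v ((ω m).q v) - ∑ v, φ v (q₀ v)| := by rw [← abs_mul, h3]
      _ ≤ _ := (abs_sub _ _).trans (add_le_add (abs_sum_env_le φ _) (abs_sum_env_le φ _))
  rw [← le_div_iff₀' (abs_pos.2 hc)] at h4
  linarith

/-- At criticality, failure to stabilize confines the chain and yields a conserved quantity. -/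
theorem isConserved_of_not_stabilizesAS [Nonempty V] (hE : ∀ v, (N.envMatrix v).IsIrreducible)
    (hπ : N.IsStationary π) (hmean : N.HasMeans) (hMOLI : N.MOLI) (hBFB : N.BFB)
    (hIRR : ToppleIrreducible (N.toppling π)) {a : V → ℝ} (ha : ∀ v, 0 < a v)
    {φ : ∀ v, S v → ℝ} (hφ : N.IsCorrector a φ 0) {η₀ : V → ℕ} {q₀ : ∀ v, S v}
    (h : ¬ N.StabilizesAS η₀ q₀) : N.IsConserved a φ := by
  have hclosed := nonnegStates_closed hMOLI hBFB
  have hharm : ∀ x ∈ nonnegStates V S, x ∈ N.unstable →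
      (N.step x).lexp (potential a φ) = potential a φ x := fun x hx hU =>
    lexp_step_eq hU fun v hv => by
      rw [(lexp_topple_potential hmean hMOLI hBFB ha hφ hx hv).2, zero_mul, add_zero, potential]
  set x₀ : State V S := ⟨fun v => η₀ v, q₀⟩
  have hx₀ : x₀ ∈ nonnegStates V S := fun v => Int.natCast_nonneg _
  have hfail : ∃ ε : ℝ≥0∞, ε ≠ 0 ∧ ∀ n, ε ≤ (killed N.step N.unstable)^[n] (fun _ => 1) x₀ := by
    by_contra! hcon
    exact h (stabilizesAS_of_forall_exists_lt hcon)
  obtain ⟨ε, hε, hεle⟩ := hfail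
  have hε2 : ε / 2 ≠ 0 := by simpa using hε
  -- At this level the maximal inequality charges less than `ε / 2` to reaching potential `L`.
  obtain ⟨L, hL⟩ := ENNReal.exists_nat_mul_gt (b := potential a φ x₀) hε2 ENNReal.ofReal_ne_top
  have hL0 : (L : ℝ≥0∞) ≠ 0 := by
    rintro h0
    simp [h0] at hL
  set F : Set (State V S) := {x | x ∈ nonnegStates V S ∧ x ∈ N.unstable ∧ potential a φ x < L}
  have hFfin : F.Finite := by
    refine (finite_nonneg_height_lt ha φ L).subset fun x hx => ⟨hx.1, ?_⟩
    have h1 : ENNReal.ofReal (height a φ x + envBound φ) < L := hx.2.2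
    rw [← ENNReal.ofReal_natCast, ENNReal.ofReal_lt_ofReal_iff_of_nonneg
      (height_add_envBound_nonneg ha φ hx.1)] at h1
    have : 0 ≤ envBound φ := Finset.sum_nonneg fun v _ => Finset.sum_nonneg fun s _ => abs_nonneg _
    linarith
  -- Otherwise survival in the finite set `F` would also drop below `ε / 2`, contradicting the lower
  -- bound `ε`.
  obtain ⟨x, hx⟩ : ∃ x, ∀ n, (killed N.step F)^[n] (fun _ => 1) x = 1 := by
    by_contra! hcon
    obtain ⟨n, hn⟩ := killed_tendsto_zero_of_finite hFfin (fun x _ => hcon x) (ε / 2) hε2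
    refine (hεle n).not_gt ?_
    refine (killed_maximal hclosed (fun x hx hU => (hharm x hx hU).le) hL0
      (ENNReal.natCast_ne_top L) n x₀ hx₀).trans_lt ?_
    rw [← ENNReal.add_halves ε]
    refine ENNReal.add_lt_add ?_ (hn x₀)
    rw [mul_comm, ← div_eq_mul_inv]
    refine ENNReal.div_lt_of_lt_mul ?_
    rwa [mul_comm]
  have hreachF : ∀ z, Reach N.step x z → z ∈ F := fun z hz =>
    mem_of_killed_eq_one (killed_eq_one_of_reach hz hx)
  obtain ⟨y, hxy, hrec⟩ := exists_reach_recurrent (κ := N.step) (x := x) (hFfin.subset hreachF)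
  have hyF : ∀ z, Reach N.step y z → z ∈ F := fun z hz => hreachF z (hxy.trans hz)
  have hconst := harmonic_const_of_recurrent (hFfin.subset hyF) hrec
    (h := potential a φ) (fun z _ => ENNReal.ofReal_ne_top)
    (fun z hz => hharm z (hyF z hz).1 (hyF z hz).2.1)
  refine (isConserved_iff q₀).2 ⟨fun h0 => ?_, ?_⟩
  · obtain ⟨v⟩ := ‹Nonempty V›
    exact (ha v).ne' (congrFun h0 v)
  · refine increment_eq_zero_of_recurrent hE hπ hMOLI hIRR (fun z hz => (hyF z hz).2.1) hrec
      fun z hz => ?_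
    have h1 := (ENNReal.ofReal_eq_ofReal_iff (height_add_envBound_nonneg ha φ (hyF z hz).1)
      (height_add_envBound_nonneg ha φ (hyF y Relation.ReflTransGen.refl).1)).1 (hconst z hz)
    linarith

end StochasticNetwork

/-! ### The three phases combined -/

theorem theorem1p1 {V : Type*} [Fintype V] [DecidableEq V]
    {S : V → Type*} [∀ v, Fintype (S v)] [∀ v, DecidableEq (S v)]
    (G : Digraph V) (hG : G.toSimpleGraphInclusive.Connected)
    (N : StochasticNetwork V S) (hE : N.EnvErgodic)
    (π : ∀ v, S v → ℝ) (hπ : N.IsStationary π)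
    (hmean : N.HasMeans) (hMOLI : N.MOLI) (hBFB : N.BFB)
    (hIRR : ToppleIrreducible (N.toppling π))
    (q₀ : ∀ v, S v) :
    (criticalParam (N.toppling π) < 0 → ∀ η₀ : V → ℕ, N.StabilizesAS η₀ q₀) ∧
    (criticalParam (N.toppling π) = 0 →
      Xor (∃ (a : V → ℝ) (φ : ∀ v, S v → ℝ), N.IsConserved a φ)
        (∀ η₀ : V → ℕ, N.StabilizesAS η₀ q₀)) ∧
    (0 < criticalParam (N.toppling π) → ∃ η₀ : V → ℕ, N.FailsToStabilize η₀ q₀) := by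
  have := hG.nonempty
  have hE' : ∀ v, (N.envMatrix v).IsIrreducible := fun v => (hE v).1
  obtain ⟨a, ha, hMa, huniq⟩ := exists_critical_eigenvector
    (StochasticNetwork.toppling_off_diag_nonneg hπ hMOLI) hIRR
  obtain ⟨φ, hφ⟩ := StochasticNetwork.exists_isCorrector hE' hπ hMa
  refine ⟨fun hρ η₀ => StochasticNetwork.stabilizesAS_of_neg hmean hMOLI hBFB ha hφ hρ η₀ q₀,
    fun hρ => ?_,
    fun hρ => StochasticNetwork.exists_failsToStabilize_of_pos hmean hMOLI hBFB ha hφ hρ q₀⟩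
  rw [hρ] at hφ huniq
  by_cases hst : ∀ η₀ : V → ℕ, N.StabilizesAS η₀ q₀
  · refine Or.inr ⟨hst, ?_⟩
    rintro ⟨b, ψ, hb⟩
    have hMb := StochasticNetwork.mulVec_toppling_eq_zero hmean hπ
      ((StochasticNetwork.isConserved_iff q₀).1 hb).2
    -- At `ρ = 0` the kernel of `M` is the critical eigenspace, spanned by `a`.
    obtain ⟨c, rfl⟩ := huniq b (by rw [hMb, zero_smul])
    obtain ⟨η₀, hη₀⟩ := StochasticNetwork.exists_not_stabilizesAS_of_isConserved ha hb q₀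
    exact hη₀ (hst η₀)
  · refine Or.inl ⟨⟨a, φ, ?_⟩, hst⟩
    obtain ⟨η₀, hη₀⟩ := not_forall.1 hst
    exact StochasticNetwork.isConserved_of_not_stabilizesAS hE' hπ hmean hMOLI hBFB hIRR ha hφ hη₀
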